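/- **Setting.** Let $\hat M=\{\hat T_i\}_{i=1}^{\ell}$ be a reference macro-element: a finite family of compact convex sets $\hat T_i\subset\mathbb R^2$ (triangles, rectangles, ...) with non-empty, pairwise disjoint interiors, such that $\Lambda:=\bigcup_i \hat T_i$ has connected interior. For a finite set $\boldsymbol R\subset\mathbb N_0^2$ of multi-indices and $\boldsymbol\gamma\in\mathbb N_0^2$ put $\boldsymbol R+\boldsymbol\gamma=\{\boldsymbol\alpha+\boldsymbol\gamma:\boldsymbol\alpha\in\boldsymbol R\}$, let $\overline{\boldsymbol R}:=\boldsymbol R\cup\{\boldsymbol\alpha+\boldsymbol e_i:\boldsymbol\alpha\in\boldsymbol R,\ i=1,2\}$ be its hull, and let $\boldsymbol R(\Lambda)$ be the span of the monomials $\boldsymbol X^{\boldsymbol\alpha}$, $\boldsymbol\alpha\in\boldsymbol R$, on $\Lambda$. For $1\le p\le\infty$ and $v\in L^1(\Lambda)$ let, with weak derivatives on the interior of $\Lambda$, $$\|v\|_{\boldsymbol R,p}:=\Big(\sum_{\boldsymbol\alpha\in\boldsymbol R}\|\boldsymbol D^{\boldsymbol\alpha}v\|_{L_p(\Lambda)}^p\Big)^{1/p},\qquad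 |v|_{\overline{\boldsymbol R},p}:=\Big(\sum_{\boldsymbol\alpha\in\overline{\boldsymbol R}\setminus\boldsymbol R}\|\boldsymbol D^{\boldsymbol\alpha}v\|_{L_p(\Lambda)}^p\Big)^{1/p}$$ (the maximum of the $L_\infty$-norms if $p=\infty$; the value is $\infty$ if one of the derivatives does not exist in $L_p$), and $H^{\boldsymbol R}_p(\Lambda):=\{v\in L^1(\Lambda):\|v\|_{\boldsymbol R,p}<\infty\}$. Since $\overline{\boldsymbol R}+\boldsymbol\gamma=\overline{\boldsymbol R+\boldsymbol\gamma}$, the semi-norm $|v|_{\overline{\boldsymbol R}+\boldsymbol\gamma,p}$ is the one over $(\overline{\boldsymbol R}\setminus\boldsymbol R)+\boldsymbol\gamma$. **Lemma.** Let $1\le p\le\infty$, let $\boldsymbol\gamma$ be a multi-index, and let $\boldsymbol P,\boldsymbol Q$ be finite sets of multi-indices with $\boldsymbol 0\in\boldsymbol P$, $\boldsymbol 0\in\boldsymbol Q$ and $\boldsymbol P\subset\overline{\boldsymbol Q}$. Let $S(\hat M)\subset H^{\boldsymbol P+\boldsymbol\gamma}_p(\Lambda)$ be a linear space of functions whose restriction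 to each $\hat T_i$ is a polynomial, let $\mu\in\mathbb N_0$, and let $I:C^\mu(\Lambda)\to S(\hat M)$ be a linear operator. Assume that there are linear functionals $F_i$, $i=1,\dots,j=\dim\boldsymbol D^{\boldsymbol\gamma}S(\hat M)$, on $H^{\overline{\boldsymbol Q}}_p(\Lambda)+\boldsymbol D^{\boldsymbol\gamma}S(\hat M)$, whose restrictions to $H^{\overline{\boldsymbol Q}}_p(\Lambda)$ are bounded with respect to $\|\cdot\|_{\overline{\boldsymbol Q},p}$, such that $$F_i(\boldsymbol D^{\boldsymbol\gamma}Iu)=F_i(\boldsymbol D^{\boldsymbol\gamma}u),\quad i=1,\dots,j,\qquad\forall u\in C^\mu(\Lambda)\cap H^{\overline{\boldsymbol Q}+\boldsymbol\gamma}_p(\Lambda),$$ $$\big(F_i(\boldsymbol D^{\boldsymbol\gamma}s)=0\ \text{ for } i=1,\dots,j\big)\ \Rightarrow\ \boldsymbol D^{\boldsymbol\gamma}s=0\qquad\forall s\in S(\hat M).$$ Then for every $u\in C^\mu(\Lambda)\cap H^{\overline{\boldsymbol Q}+\boldsymbol\gamma}_p(\Lambda)$ there is a unique polynomial $q=q_u\in(\boldsymbol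 Q+\boldsymbol\gamma)(\Lambda)$ with $$\int_\Lambda\boldsymbol D^{\boldsymbol\alpha+\boldsymbol\gamma}(u-q)\,\mathrm d\boldsymbol X=0\qquad\forall\boldsymbol\alpha\in\boldsymbol Q,$$ and there is a constant $C$ independent of $u$ such that $$\|u-Iu\|_{\boldsymbol P+\boldsymbol\gamma,p}\le C\big(|u|_{\overline{\boldsymbol Q}+\boldsymbol\gamma,p}+\|q_u-Iq_u\|_{\boldsymbol P+\boldsymbol\gamma,p}\big)\qquad\forall u\in C^\mu(\Lambda)\cap H^{\overline{\boldsymbol Q}+\boldsymbol\gamma}_p(\Lambda).$$ -/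

import Mathlib

open MeasureTheory Set
open scoped ENNReal NNReal ContDiff

noncomputable section

/-- The hull `P ∪ {α + e₁, α + e₂ : α ∈ P}` of a finite set of multi-indices. -/
def hull (P : Finset (ℕ × ℕ)) : Finset (ℕ × ℕ) :=
  P ∪ P.image (fun α => α + (1, 0)) ∪ P.image (fun α => α + (0, 1))

/-- The translate `P + γ`. -/
def shift (γ : ℕ × ℕ) (P : Finset (ℕ × ℕ)) : Finset (ℕ × ℕ) :=
  P.image (fun α => α + γ)

/-- The classical derivative `∂ₓ^α₁ ∂_y^α₂ φ` of a smooth function on the plane. -/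
def classicalDeriv (α : ℕ × ℕ) (φ : ℝ × ℝ → ℝ) : ℝ × ℝ → ℝ :=
  (fun f z => fderiv ℝ f z (1, 0))^[α.1] ((fun f z => fderiv ℝ f z (0, 1))^[α.2] φ)

/-- The derivative of a smooth compactly supported function is continuous and compactly
supported. -/
theorem classicalDeriv_aux (α : ℕ × ℕ) {φ : ℝ × ℝ → ℝ} (h : ContDiff ℝ ∞ φ)
    (hc : HasCompactSupport φ) :
    ContDiff ℝ ∞ (classicalDeriv α φ) ∧ HasCompactSupport (classicalDeriv α φ) := by
  have key : ∀ (e : ℝ × ℝ) (n : ℕ) (f : ℝ × ℝ → ℝ), ContDiff ℝ ∞ f ∧ HasCompactSupport f →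
      ContDiff ℝ ∞ ((fun (f : ℝ × ℝ → ℝ) z => fderiv ℝ f z e)^[n] f) ∧
        HasCompactSupport ((fun (f : ℝ × ℝ → ℝ) z => fderiv ℝ f z e)^[n] f) := by
    intro e n
    induction n with
    | zero => intro f hf; simpa using hf
    | succ n ih =>
      intro f hf
      rw [Function.iterate_succ_apply]
      refine ih _ ⟨?_, hf.2.fderiv_apply ℝ e⟩
      exact (hf.1.fderiv_right (m := ∞) (by simp)).clm_apply contDiff_const
  exact key _ _ _ (key _ _ _ ⟨h, hc⟩)

/-- `L¹(Ω)`, functions modulo equality almost everywhere. -/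
abbrev L1 (Ω : Set (ℝ × ℝ)) : Type := Lp ℝ 1 (volume.restrict Ω)

/-- `g ∈ L¹(Ω)` is the weak derivative `D^α v` of `v ∈ L¹(Ω)`. -/
def HasWeakDeriv (Ω : Set (ℝ × ℝ)) (α : ℕ × ℕ) (v g : L1 Ω) : Prop :=
  ∀ φ : ℝ × ℝ → ℝ, ContDiff ℝ ∞ φ → HasCompactSupport φ → tsupport φ ⊆ Ω →
    ∫ z in Ω, v z * classicalDeriv α φ z = (-1) ^ (α.1 + α.2) * ∫ z in Ω, g z * φ z

theorem integrable_L1_mul {Ω : Set (ℝ × ℝ)} (v : L1 Ω) {ψ : ℝ × ℝ → ℝ} (h : Continuous ψ)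
    (hc : HasCompactSupport ψ) : Integrable (fun z => v z * ψ z) (volume.restrict Ω) := by
  obtain ⟨C, hC⟩ := h.bounded_above_of_compact_support hc
  exact (L1.integrable_coeFn v).mul_bdd (c := C) h.aestronglyMeasurable
    (Filter.Eventually.of_forall hC)

theorem integral_L1_add_mul {Ω : Set (ℝ × ℝ)} (v w : L1 Ω) {ψ : ℝ × ℝ → ℝ} (h : Continuous ψ)
    (hc : HasCompactSupport ψ) :
    ∫ z in Ω, (v + w : L1 Ω) z * ψ z = (∫ z in Ω, v z * ψ z) + ∫ z in Ω, w z * ψ z := by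
  rw [← integral_add (integrable_L1_mul v h hc) (integrable_L1_mul w h hc)]
  refine integral_congr_ae ?_
  filter_upwards [Lp.coeFn_add v w] with z hz
  rw [hz, Pi.add_apply, add_mul]

theorem integral_L1_smul_mul {Ω : Set (ℝ × ℝ)} (c : ℝ) (v : L1 Ω) (ψ : ℝ × ℝ → ℝ) :
    ∫ z in Ω, (c • v : L1 Ω) z * ψ z = c * ∫ z in Ω, v z * ψ z := by
  rw [← integral_const_mul]
  refine integral_congr_ae ?_
  filter_upwards [Lp.coeFn_smul c v] with z hz
  rw [hz, Pi.smul_apply, smul_eq_mul, mul_assoc]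

theorem HasWeakDeriv.add {Ω : Set (ℝ × ℝ)} {α : ℕ × ℕ} {v w g k : L1 Ω}
    (h : HasWeakDeriv Ω α v g) (h' : HasWeakDeriv Ω α w k) :
    HasWeakDeriv Ω α (v + w) (g + k) := by
  intro φ hφ hc hs
  obtain ⟨hd, hdc⟩ := classicalDeriv_aux α hφ hc
  rw [integral_L1_add_mul v w hd.continuous hdc, integral_L1_add_mul g k hφ.continuous hc,
    h φ hφ hc hs, h' φ hφ hc hs, mul_add]

theorem HasWeakDeriv.smul {Ω : Set (ℝ × ℝ)} {α : ℕ × ℕ} {v g : L1 Ω} (c : ℝ)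
    (h : HasWeakDeriv Ω α v g) : HasWeakDeriv Ω α (c • v) (c • g) := by
  intro φ hφ hc hs
  rw [integral_L1_smul_mul, integral_L1_smul_mul, h φ hφ hc hs]
  ring

theorem HasWeakDeriv.zero (Ω : Set (ℝ × ℝ)) (α : ℕ × ℕ) : HasWeakDeriv Ω α 0 0 := by
  intro φ hφ hc hs
  have h (ψ : ℝ × ℝ → ℝ) : ∫ z in Ω, (0 : L1 Ω) z * ψ z = 0 := by
    simpa using integral_L1_smul_mul (0 : ℝ) (0 : L1 Ω) ψ
  rw [h, h, mul_zero]

/-- `‖D^α v‖_{L_p(Ω)}`, with the value `∞` if `v` has no weak derivative `D^α v` in `L¹(Ω)`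
(weak derivatives on an open set are unique, so that the infimum runs over at most one `g`). -/
def derivNorm (Ω : Set (ℝ × ℝ)) (α : ℕ × ℕ) (p : ℝ≥0∞) (v : L1 Ω) : ℝ≥0∞ :=
  ⨅ (g : L1 Ω) (_ : HasWeakDeriv Ω α v g), eLpNorm g p (volume.restrict Ω)

/-- `‖v‖_{P,p} = (∑_{α ∈ P} ‖D^α v‖_{L_p}^p)^{1/p}`, and the maximum for `p = ∞`. -/
def sobNorm (Ω : Set (ℝ × ℝ)) (P : Finset (ℕ × ℕ)) (p : ℝ≥0∞) (v : L1 Ω) : ℝ≥0∞ :=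
  if p = ⊤ then P.sup (fun α => derivNorm Ω α p v)
  else (∑ α ∈ P, derivNorm Ω α p v ^ p.toReal) ^ (1 / p.toReal)

/-- The semi-norm `|v|_{hull P, p}`: as the norm, but over the multi-indices in
`hull P \ P` only. -/
def sobSemi (Ω : Set (ℝ × ℝ)) (P : Finset (ℕ × ℕ)) (p : ℝ≥0∞) (v : L1 Ω) : ℝ≥0∞ :=
  sobNorm Ω (hull P \ P) p v

theorem derivNorm_lt_top {Ω : Set (ℝ × ℝ)} {α : ℕ × ℕ} {p : ℝ≥0∞} {v : L1 Ω} :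
    derivNorm Ω α p v < ⊤ ↔
      ∃ g : L1 Ω, HasWeakDeriv Ω α v g ∧ MemLp g p (volume.restrict Ω) := by
  simp only [derivNorm, iInf_lt_iff]
  constructor
  · rintro ⟨g, hg, h⟩
    exact ⟨g, hg, Lp.aestronglyMeasurable g, h⟩
  · rintro ⟨g, hg, h⟩
    exact ⟨g, hg, h.2⟩

theorem sobNorm_lt_top {Ω : Set (ℝ × ℝ)} {P : Finset (ℕ × ℕ)} {p : ℝ≥0∞} (hp : 1 ≤ p)
    {v : L1 Ω} : sobNorm Ω P p v < ⊤ ↔ ∀ α ∈ P, derivNorm Ω α p v < ⊤ := by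
  unfold sobNorm
  split_ifs with h
  · exact Finset.sup_lt_iff (by simp)
  · have h0 : 0 < p.toReal := ENNReal.toReal_pos (zero_lt_one.trans_le hp).ne' h
    rw [ENNReal.rpow_lt_top_iff_of_pos (by positivity), ENNReal.sum_lt_top]
    simp only [ENNReal.rpow_lt_top_iff_of_pos h0]

/-- The space `H^P_p(Ω) = {v ∈ L¹(Ω) : ‖v‖_{P,p} < ∞}`, for `1 ≤ p ≤ ∞`. -/
def sobolev (Ω : Set (ℝ × ℝ)) (P : Finset (ℕ × ℕ)) (p : ℝ≥0∞) [hp : Fact (1 ≤ p)] :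
    Submodule ℝ (L1 Ω) where
  carrier := {v | sobNorm Ω P p v < ⊤}
  zero_mem' := by
    refine (sobNorm_lt_top hp.out).2 fun α _ => derivNorm_lt_top.2 ⟨0, HasWeakDeriv.zero Ω α, ?_⟩
    exact (memLp_congr_ae (Lp.coeFn_zero ℝ 1 (volume.restrict Ω))).2 MemLp.zero
  add_mem' := by
    intro v w hv hw
    refine (sobNorm_lt_top hp.out).2 fun α hα => derivNorm_lt_top.2 ?_
    obtain ⟨g, hg, hgp⟩ := derivNorm_lt_top.1 ((sobNorm_lt_top hp.out).1 hv α hα)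
    obtain ⟨k, hk, hkp⟩ := derivNorm_lt_top.1 ((sobNorm_lt_top hp.out).1 hw α hα)
    exact ⟨g + k, hg.add hk, (memLp_congr_ae (Lp.coeFn_add g k)).2 (hgp.add hkp)⟩
  smul_mem' := by
    intro c v hv
    refine (sobNorm_lt_top hp.out).2 fun α hα => derivNorm_lt_top.2 ?_
    obtain ⟨g, hg, hgp⟩ := derivNorm_lt_top.1 ((sobNorm_lt_top hp.out).1 hv α hα)
    exact ⟨c • g, hg.smul c, (memLp_congr_ae (Lp.coeFn_smul c g)).2 (hgp.const_smul c)⟩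

/-- The space `D^γ S = {D^γ s : s ∈ S}`. -/
def derivSpace {Ω : Set (ℝ × ℝ)} (γ : ℕ × ℕ) (S : Submodule ℝ (L1 Ω)) :
    Submodule ℝ (L1 Ω) where
  carrier := {w | ∃ s ∈ S, HasWeakDeriv Ω γ s w}
  zero_mem' := ⟨0, S.zero_mem, HasWeakDeriv.zero Ω γ⟩
  add_mem' := by
    rintro v w ⟨s, hs, h⟩ ⟨t, ht, h'⟩
    exact ⟨s + t, S.add_mem hs ht, h.add h'⟩
  smul_mem' := by
    rintro c v ⟨s, hs, h⟩
    exact ⟨c • s, S.smul_mem c hs, h.smul c⟩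

/-- A macro-element: a finite family of non-overlapping compact convex elements with non-empty
interior (triangles, rectangles, ...) that triangulates a reference domain, i.e. the interior of
the union is connected. -/
structure MacroElement where
  card : ℕ
  elem : Fin card → Set (ℝ × ℝ)
  isCompact_elem : ∀ i, IsCompact (elem i)
  convex_elem : ∀ i, Convex ℝ (elem i)
  interior_elem : ∀ i, (interior (elem i)).Nonempty
  disjoint_elem : ∀ i k, i ≠ k → Disjoint (interior (elem i)) (interior (elem k))
  isConnected_interior : IsConnected (interior (⋃ i, elem i))

namespace MacroElement

/-- The closed reference domain `Λ`, the union of the elements. -/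
def dom (M : MacroElement) : Set (ℝ × ℝ) := ⋃ i, M.elem i

/-- The open reference domain, which differs from `Λ` by a null set. -/
def Ω (M : MacroElement) : Set (ℝ × ℝ) := interior M.dom

theorem isCompact_dom (M : MacroElement) : IsCompact M.dom :=
  isCompact_iUnion M.isCompact_elem

/-- The space `C^μ(Λ)` of functions on the closed set `Λ` that are `μ` times continuously
differentiable up to the boundary. -/
def CSpace (M : MacroElement) (μ : ℕ) : Submodule ℝ (M.dom → ℝ) where
  carrier := {f | ∃ g : ℝ × ℝ → ℝ, ContDiffOn ℝ μ g M.dom ∧ ∀ z : M.dom, f z = g z}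
  zero_mem' := ⟨fun _ => 0, contDiffOn_const, fun _ => rfl⟩
  add_mem' := by
    rintro f f' ⟨g, hg, h⟩ ⟨g', hg', h'⟩
    exact ⟨g + g', hg.add hg', fun z => by simp [h, h']⟩
  smul_mem' := by
    rintro c f ⟨g, hg, h⟩
    exact ⟨c • g, hg.const_smul c, fun z => by simp [h]⟩

open Classical in
/-- Extension by zero of a function on `Λ`. -/
def zeroExt (M : MacroElement) (f : M.dom → ℝ) (z : ℝ × ℝ) : ℝ :=
  if h : z ∈ M.dom then f ⟨z, h⟩ else 0

theorem integrable_zeroExt (M : MacroElement) {μ : ℕ} (u : M.CSpace μ) :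
    Integrable (M.zeroExt u.1) (volume.restrict M.Ω) := by
  obtain ⟨f, g, hg, h⟩ := u
  have h1 : IntegrableOn g M.dom :=
    hg.continuousOn.integrableOn_compact M.isCompact_dom
  have h2 : IntegrableOn (M.zeroExt f) M.dom := by
    refine h1.congr_fun (fun z hz => ?_) M.isCompact_dom.measurableSet
    simp [zeroExt, hz, h]
  exact h2.mono_set interior_subset

/-- The canonical embedding `C^μ(Λ) → L¹(Λ)`. -/
def toL1 (M : MacroElement) (μ : ℕ) : M.CSpace μ →ₗ[ℝ] L1 M.Ω where
  toFun u := (M.integrable_zeroExt u).toL1 _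
  map_add' u v := by
    rw [← Integrable.toL1_add]
    congr 1
    funext z
    by_cases h : z ∈ M.dom <;> simp [zeroExt, h]
  map_smul' c u := by
    rw [RingHom.id_apply, ← Integrable.toL1_smul]
    congr 1
    funext z
    by_cases h : z ∈ M.dom <;> simp [zeroExt, h]

/-- The monomial `x^α₁ y^α₂` as a function on `Λ`. -/
def monomial (M : MacroElement) (μ : ℕ) (α : ℕ × ℕ) : M.CSpace μ :=
  ⟨fun z => z.1.1 ^ α.1 * z.1.2 ^ α.2, fun z => z.1 ^ α.1 * z.2 ^ α.2,
    by fun_prop, fun _ => rfl⟩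

/-- The polynomial space `P(Λ)` spanned by the monomials with exponents in `P`. -/
def polySpace (M : MacroElement) (μ : ℕ) (P : Finset (ℕ × ℕ)) : Submodule ℝ (M.CSpace μ) :=
  Submodule.span ℝ (M.monomial μ '' P)

/-- All elements of `S` are polynomials on every element. -/
def IsPiecewisePolynomial (M : MacroElement) (S : Submodule ℝ (L1 M.Ω)) : Prop :=
  ∀ s ∈ S, ∀ i, ∃ r : MvPolynomial (Fin 2) ℝ,
    ∀ᵐ z ∂(volume.restrict (interior (M.elem i))), s z = MvPolynomial.eval ![z.1, z.2] r

/-- `q` belongs to `(Q + γ)(Λ)` and `∫_Λ D^{α+γ} (u - q) = 0` for all `α ∈ Q`. -/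
def IsMeanPolynomial (M : MacroElement) {μ : ℕ} (Q : Finset (ℕ × ℕ)) (γ : ℕ × ℕ)
    (u q : M.CSpace μ) : Prop :=
  q ∈ M.polySpace μ (shift γ Q) ∧
    ∀ α ∈ Q, ∃ g : L1 M.Ω,
      HasWeakDeriv M.Ω (α + γ) (M.toL1 μ (u - q)) g ∧ ∫ z in M.Ω, g z = 0

end MacroElement

end

/-!
On a convex open set the mean oscillation of `f` is bounded by its gradient: integrate along the
segment between two points, of which a uniformly distributed point has a bounded density, after
mollifying `f` on the points at distance more than the radius from the boundary. The interiors of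
the elements fill `Ω` up to a null set and `Ω` is connected, so overlapping balls glue these bounds
to Poincaré's inequality on `Ω`.

If the derivatives of `w` over `Q` have vanishing means, Poincaré's inequality and an induction
along `hull Q` bound all derivatives over `hull Q` by those over `hull Q \ Q`. The means determine
the mean value polynomial `q` of `u` through a triangular system. As `Q` need not be a lower set,
derivatives of `q` over `hull Q \ Q` need not vanish, but the coefficients entering them are
controlled by the semi-norm of `u`, by the same induction restricted to larger multi-indices. Hence
`w = u - q` is bounded by the semi-norm of `u`. On the finite-dimensional space `D^γ S` the norming
functionals dominate every norm, so `I w` is bounded by `w`, and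
`u - I u = (w - I w) + (q - I q)`.
-/

/-! ### Calculus of weak derivatives -/

section DirDeriv

variable {E : Type*} [NormedAddCommGroup E] [NormedSpace ℝ E] {f φ : E → ℝ}

/-- The derivative of `f` in the direction `e`, as a function on the whole space; the classical
derivatives are iterates of it in the coordinate directions. -/
noncomputable def dirDeriv (e : E) (f : E → ℝ) : E → ℝ :=
  fun z => fderiv ℝ f z e

theorem contDiff_dirDeriv (e : E) (hf : ContDiff ℝ ∞ f) : ContDiff ℝ ∞ (dirDeriv e f) :=
  (hf.fderiv_right (m := ∞) (by simp)).clm_apply contDiff_const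

theorem contDiff_iterate_dirDeriv (e : E) (n : ℕ) (hf : ContDiff ℝ ∞ f) :
    ContDiff ℝ ∞ ((dirDeriv e)^[n] f) := by
  induction n with
  | zero => exact hf
  | succ n ih =>
    rw [Function.iterate_succ_apply']
    exact contDiff_dirDeriv e ih

theorem hasCompactSupport_iterate_dirDeriv (e : E) (n : ℕ) (hc : HasCompactSupport φ) :
    HasCompactSupport ((dirDeriv e)^[n] φ) := by
  induction n with
  | zero => exact hc
  | succ n ih =>
    rw [Function.iterate_succ_apply']
    exact ih.fderiv_apply ℝ e

theorem tsupport_iterate_dirDeriv_subset (e : E) (n : ℕ) (φ : E → ℝ) :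
    tsupport ((dirDeriv e)^[n] φ) ⊆ tsupport φ := by
  induction n with
  | zero => rfl
  | succ n ih =>
    rw [Function.iterate_succ_apply']
    exact (tsupport_fderiv_apply_subset ℝ e).trans ih

theorem dirDeriv_comm (e e' : E) (hf : ContDiff ℝ ∞ f) :
    dirDeriv e (dirDeriv e' f) = dirDeriv e' (dirDeriv e f) := by
  funext z
  have hd : DifferentiableAt ℝ (fderiv ℝ f) z :=
    (hf.fderiv_right (m := ∞) (by simp)).differentiable (by simp) z
  have hsymm : IsSymmSndFDerivAt ℝ f z :=
    (contDiff_infty.1 hf 2).contDiffAt.isSymmSndFDerivAt (by simp)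
  have second_deriv (a b : E) : dirDeriv a (dirDeriv b f) z = fderiv ℝ (fderiv ℝ f) z a b := by
    change fderiv ℝ (fun y => fderiv ℝ f y b) z a = _
    rw [fderiv_clm_apply hd (by fun_prop)]
    simp
  rw [second_deriv, second_deriv, hsymm]

theorem iterate_dirDeriv_comm (e e' : E) (m n : ℕ) (hf : ContDiff ℝ ∞ f) :
    (dirDeriv e)^[m] ((dirDeriv e')^[n] f) = (dirDeriv e')^[n] ((dirDeriv e)^[m] f) := by
  have single (n : ℕ) {g : E → ℝ} (hg : ContDiff ℝ ∞ g) :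
      dirDeriv e ((dirDeriv e')^[n] g) = (dirDeriv e')^[n] (dirDeriv e g) := by
    induction n generalizing g with
    | zero => rfl
    | succ n ih =>
      rw [Function.iterate_succ_apply, ih (contDiff_dirDeriv e' hg), dirDeriv_comm e e' hg,
        Function.iterate_succ_apply]
  induction m with
  | zero => rfl
  | succ m ih =>
    rw [Function.iterate_succ_apply', ih, single n (contDiff_iterate_dirDeriv e m hf),
      ← Function.iterate_succ_apply' (dirDeriv e)]

theorem dirDeriv_comp_const_sub (hf : Differentiable ℝ f) (e x t : E) :
    dirDeriv e (fun t => f (x - t)) t = -dirDeriv e f (x - t) := by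
  have hcomp := (hf (x - t)).hasFDerivAt.comp t ((hasFDerivAt_id t).const_sub x)
  change fderiv ℝ (f ∘ fun t => x - t) t e = _
  rw [hcomp.fderiv]
  simp [dirDeriv]

theorem integral_mul_iterate_dirDeriv [FiniteDimensional ℝ E] [MeasurableSpace E] [BorelSpace E]
    (μ : Measure E) [μ.IsAddHaarMeasure] (e : E) (n : ℕ) (hf : ContDiff ℝ ∞ f)
    (hφ : ContDiff ℝ ∞ φ) (hc : HasCompactSupport φ) :
    ∫ z, f z * (dirDeriv e)^[n] φ z ∂μ = (-1) ^ n * ∫ z, (dirDeriv e)^[n] f z * φ z ∂μ := by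
  induction n generalizing f with
  | zero => simp
  | succ n ih =>
    have hD := contDiff_iterate_dirDeriv e n hφ
    have hDc := hasCompactSupport_iterate_dirDeriv e n hc
    have hDf := contDiff_dirDeriv e hf
    have by_parts : ∫ z, f z * dirDeriv e ((dirDeriv e)^[n] φ) z ∂μ =
        -∫ z, dirDeriv e f z * (dirDeriv e)^[n] φ z ∂μ :=
      integral_mul_fderiv_eq_neg_fderiv_mul_of_integrable
        ((hDf.continuous.mul hD.continuous).integrable_of_hasCompactSupport hDc.mul_left)
        ((hf.continuous.mul (contDiff_dirDeriv e hD).continuous).integrable_of_hasCompactSupport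
          (hDc.fderiv_apply ℝ e).mul_left)
        ((hf.continuous.mul hD.continuous).integrable_of_hasCompactSupport hDc.mul_left)
        (fun z _ => hf.differentiable (by simp) z) (fun z _ => hD.differentiable (by simp) z)
    rw [Function.iterate_succ_apply', by_parts, ih hDf, Function.iterate_succ_apply]
    ring

end DirDeriv

section ClassicalDeriv

variable {f φ : ℝ × ℝ → ℝ}

theorem tsupport_classicalDeriv_subset (α : ℕ × ℕ) (φ : ℝ × ℝ → ℝ) :
    tsupport (classicalDeriv α φ) ⊆ tsupport φ :=
  (tsupport_iterate_dirDeriv_subset (1, 0) α.1 _).trans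
    (tsupport_iterate_dirDeriv_subset (0, 1) α.2 φ)

theorem classicalDeriv_classicalDeriv (α β : ℕ × ℕ) (h : ContDiff ℝ ∞ φ) :
    classicalDeriv α (classicalDeriv β φ) = classicalDeriv (α + β) φ := by
  change (dirDeriv (1, 0))^[α.1] ((dirDeriv (0, 1))^[α.2] ((dirDeriv (1, 0))^[β.1]
      ((dirDeriv (0, 1))^[β.2] φ))) =
    (dirDeriv (1, 0))^[α.1 + β.1] ((dirDeriv (0, 1))^[α.2 + β.2] φ)
  rw [iterate_dirDeriv_comm (0, 1) (1, 0) α.2 β.1 (contDiff_iterate_dirDeriv (0, 1) β.2 h),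
    ← Function.iterate_add_apply, ← Function.iterate_add_apply]

theorem integral_mul_classicalDeriv (α : ℕ × ℕ) (hf : ContDiff ℝ ∞ f) (hφ : ContDiff ℝ ∞ φ)
    (hc : HasCompactSupport φ) :
    ∫ z, f z * classicalDeriv α φ z = (-1) ^ (α.1 + α.2) * ∫ z, classicalDeriv α f z * φ z := by
  change ∫ z, f z * (dirDeriv (1, 0))^[α.1] ((dirDeriv (0, 1))^[α.2] φ) z =
    (-1) ^ (α.1 + α.2) * ∫ z, (dirDeriv (1, 0))^[α.1] ((dirDeriv (0, 1))^[α.2] f) z * φ z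
  rw [integral_mul_iterate_dirDeriv volume (1, 0) α.1 hf (contDiff_iterate_dirDeriv _ _ hφ)
      (hasCompactSupport_iterate_dirDeriv _ _ hc),
    integral_mul_iterate_dirDeriv volume (0, 1) α.2 (contDiff_iterate_dirDeriv _ _ hf) hφ hc,
    iterate_dirDeriv_comm (0, 1) (1, 0) α.2 α.1 hf, pow_add, mul_assoc]

theorem iterate_dirDeriv_fst_monomial (n a b : ℕ) (c : ℝ) :
    (dirDeriv (1, 0))^[n] (fun z : ℝ × ℝ => c * (z.1 ^ a * z.2 ^ b)) =
      fun z => c * a.descFactorial n * (z.1 ^ (a - n) * z.2 ^ b) := by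
  induction n with
  | zero => simp
  | succ n ih =>
    rw [Function.iterate_succ_apply', ih]
    funext z
    have hz : HasFDerivAt (fun z : ℝ × ℝ => c * (a.descFactorial n : ℝ) *
        (z.1 ^ (a - n) * z.2 ^ b)) _ z :=
      (((hasFDerivAt_fst (𝕜 := ℝ) (p := z)).pow (a - n)).mul
        ((hasFDerivAt_snd (𝕜 := ℝ) (p := z)).pow b)).const_mul _
    rw [dirDeriv, hz.fderiv, Nat.descFactorial_succ, Nat.sub_sub]
    simp
    ring

theorem iterate_dirDeriv_snd_monomial (n a b : ℕ) (c : ℝ) :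
    (dirDeriv (0, 1))^[n] (fun z : ℝ × ℝ => c * (z.1 ^ a * z.2 ^ b)) =
      fun z => c * b.descFactorial n * (z.1 ^ a * z.2 ^ (b - n)) := by
  induction n with
  | zero => simp
  | succ n ih =>
    rw [Function.iterate_succ_apply', ih]
    funext z
    have hz : HasFDerivAt (fun z : ℝ × ℝ => c * (b.descFactorial n : ℝ) *
        (z.1 ^ a * z.2 ^ (b - n))) _ z :=
      (((hasFDerivAt_fst (𝕜 := ℝ) (p := z)).pow a).mul
        ((hasFDerivAt_snd (𝕜 := ℝ) (p := z)).pow (b - n))).const_mul _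
    rw [dirDeriv, hz.fderiv, Nat.descFactorial_succ, Nat.sub_sub]
    simp
    ring

theorem classicalDeriv_monomial (α β : ℕ × ℕ) :
    classicalDeriv α (fun z => z.1 ^ β.1 * z.2 ^ β.2) = fun z =>
      ((β.1.descFactorial α.1 : ℝ) * (β.2.descFactorial α.2 : ℝ)) *
        (z.1 ^ (β.1 - α.1) * z.2 ^ (β.2 - α.2)) := by
  have hsnd := iterate_dirDeriv_snd_monomial α.2 β.1 β.2 1
  simp only [one_mul] at hsnd
  change (dirDeriv (1, 0))^[α.1] ((dirDeriv (0, 1))^[α.2] _) = _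
  rw [hsnd, iterate_dirDeriv_fst_monomial]
  funext z
  ring

end ClassicalDeriv

section WeakDeriv

variable {Ω : Set (ℝ × ℝ)} {α : ℕ × ℕ}

theorem setIntegral_mul_eq_integral_mul {f ψ : ℝ × ℝ → ℝ} {v : L1 Ω}
    (hv : v =ᵐ[volume.restrict Ω] f) (hs : tsupport ψ ⊆ Ω) :
    ∫ z in Ω, v z * ψ z = ∫ z, f z * ψ z := by
  have hvf : (fun z => v z * ψ z) =ᵐ[volume.restrict Ω] fun z => f z * ψ z :=
    hv.mono fun z hz => by simp only [hz]
  rw [integral_congr_ae hvf, setIntegral_eq_integral_of_forall_compl_eq_zero]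
  intro z hz
  rw [image_eq_zero_of_notMem_tsupport fun hz' => hz (hs hz'), mul_zero]

theorem HasWeakDeriv.of_contDiff {f : ℝ × ℝ → ℝ} (hf : ContDiff ℝ ∞ f) {v g : L1 Ω}
    (hv : v =ᵐ[volume.restrict Ω] f) (hg : g =ᵐ[volume.restrict Ω] classicalDeriv α f) :
    HasWeakDeriv Ω α v g := by
  intro φ hφ hc hs
  rw [setIntegral_mul_eq_integral_mul hv ((tsupport_classicalDeriv_subset α φ).trans hs),
    setIntegral_mul_eq_integral_mul hg hs, integral_mul_classicalDeriv α hf hφ hc]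

theorem HasWeakDeriv.sub {v w g k : L1 Ω} (h : HasWeakDeriv Ω α v g)
    (h' : HasWeakDeriv Ω α w k) : HasWeakDeriv Ω α (v - w) (g - k) := by
  simpa [sub_eq_add_neg] using h.add (h'.smul (-1))

theorem HasWeakDeriv.sum {ι : Type*} (s : Finset ι) {v g : ι → L1 Ω}
    (h : ∀ i ∈ s, HasWeakDeriv Ω α (v i) (g i)) :
    HasWeakDeriv Ω α (∑ i ∈ s, v i) (∑ i ∈ s, g i) := by
  classical
  induction s using Finset.induction_on with
  | empty => simpa using HasWeakDeriv.zero Ω α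
  | insert i s hi ih =>
    rw [Finset.sum_insert hi, Finset.sum_insert hi]
    exact (h i (by simp)).add (ih fun k hk => h k (by simp [hk]))

theorem HasWeakDeriv.eq_zero (hΩ : IsOpen Ω) {g : L1 Ω} (h : HasWeakDeriv Ω α 0 g) : g = 0 := by
  have hloc : LocallyIntegrableOn g Ω volume :=
    IntegrableOn.locallyIntegrableOn (L1.integrable_coeFn g)
  have h0 := hΩ.ae_eq_zero_of_integral_contDiff_smul_eq_zero hloc fun φ hφ hc hs => by
    have hzero := integral_L1_smul_mul (0 : ℝ) (0 : L1 Ω) (classicalDeriv α φ)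
    rw [smul_zero, zero_mul, h φ hφ hc hs] at hzero
    have hg : ∫ z in Ω, g z * φ z = 0 := (mul_eq_zero.1 hzero).resolve_left (by simp)
    simpa only [smul_eq_mul, mul_comm] using
      (setIntegral_mul_eq_integral_mul .rfl hs).symm.trans hg
  exact (Lp.eq_zero_iff_ae_eq_zero).2 ((ae_restrict_iff' hΩ.measurableSet).2 h0)

theorem HasWeakDeriv.unique (hΩ : IsOpen Ω) {v g k : L1 Ω} (h : HasWeakDeriv Ω α v g)
    (h' : HasWeakDeriv Ω α v k) : g = k :=
  sub_eq_zero.1 (HasWeakDeriv.eq_zero hΩ (sub_self v ▸ h.sub h'))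

theorem HasWeakDeriv.hasWeakDeriv_add_iff {γ : ℕ × ℕ} {u v g : L1 Ω} (h : HasWeakDeriv Ω γ u v) :
    HasWeakDeriv Ω (α + γ) u g ↔ HasWeakDeriv Ω α v g := by
  refine forall₄_congr fun φ hφ hc hs => ?_
  obtain ⟨hD, hDc⟩ := classicalDeriv_aux α hφ hc
  have hsign : α.1 + γ.1 + (α.2 + γ.2) = (γ.1 + γ.2) + (α.1 + α.2) := by ring
  rw [add_comm α γ, ← classicalDeriv_classicalDeriv γ α hφ,
    h _ hD hDc ((tsupport_classicalDeriv_subset α φ).trans hs), add_comm γ α, Prod.fst_add,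
    Prod.snd_add, hsign, pow_add _ (γ.1 + γ.2), mul_assoc, mul_right_inj' (by simp)]

theorem HasWeakDeriv.derivNorm_add_eq {γ : ℕ × ℕ} {u v : L1 Ω} (h : HasWeakDeriv Ω γ u v)
    (α : ℕ × ℕ) (p : ℝ≥0∞) : derivNorm Ω (α + γ) p u = derivNorm Ω α p v := by
  simp only [derivNorm, h.hasWeakDeriv_add_iff]

theorem derivNorm_eq (hΩ : IsOpen Ω) {v g : L1 Ω} (h : HasWeakDeriv Ω α v g) (p : ℝ≥0∞) :
    derivNorm Ω α p v = eLpNorm g p (volume.restrict Ω) :=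
  le_antisymm (iInf₂_le g h) (le_iInf₂ fun k hk => by rw [h.unique hΩ hk])

end WeakDeriv

/-! ### The Poincaré inequality on convex sets -/

theorem eLpNorm_integral_prod_le {X Y G : Type*} [MeasurableSpace X] [MeasurableSpace Y]
    [NormedAddCommGroup G] [NormedSpace ℝ G] {μ : Measure X} [SFinite μ] {κ : Measure Y}
    [IsProbabilityMeasure κ] {p : ℝ≥0∞} (hp : 1 ≤ p) {H : X × Y → G}
    (hH : AEStronglyMeasurable H (μ.prod κ)) :
    eLpNorm (fun x => ∫ y, H (x, y) ∂κ) p μ ≤ eLpNorm H p (μ.prod κ) := by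
  rcases eq_or_ne p ⊤ with rfl | hpt
  · refine eLpNormEssSup_le_of_ae_enorm_bound ?_
    have hbound : ∀ᵐ z ∂μ.prod κ, ‖H z‖ₑ ≤ eLpNorm H ⊤ (μ.prod κ) :=
      enorm_ae_le_eLpNormEssSup _ _
    filter_upwards [Measure.ae_ae_of_ae_prod hbound] with x hx
    refine (enorm_integral_le_lintegral_enorm _).trans ((lintegral_mono_ae hx).trans ?_)
    simp
  · have hp0 : p ≠ 0 := (zero_lt_one.trans_le hp).ne'
    have hr : 0 < p.toReal := ENNReal.toReal_pos hp0 hpt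
    rw [eLpNorm_eq_lintegral_rpow_enorm_toReal hp0 hpt,
      eLpNorm_eq_lintegral_rpow_enorm_toReal hp0 hpt, lintegral_prod _ (hH.enorm.pow_const _)]
    gcongr ?_ ^ (1 / p.toReal)
    refine lintegral_mono_ae ?_
    filter_upwards [hH.prodMk_left] with x hx
    have jensen : eLpNorm (fun y => H (x, y)) 1 κ ≤ eLpNorm (fun y => H (x, y)) p κ :=
      eLpNorm_le_eLpNorm_of_exponent_le hp hx
    rw [eLpNorm_one_eq_lintegral_enorm, eLpNorm_eq_lintegral_rpow_enorm_toReal hp0 hpt] at jensen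
    calc ‖∫ y, H (x, y) ∂κ‖ₑ ^ p.toReal
        ≤ ((∫⁻ y, ‖H (x, y)‖ₑ ^ p.toReal ∂κ) ^ (1 / p.toReal)) ^ p.toReal := by
          gcongr
          exact (enorm_integral_le_lintegral_enorm _).trans jensen
      _ = ∫⁻ y, ‖H (x, y)‖ₑ ^ p.toReal ∂κ := by
          rw [← ENNReal.rpow_mul, one_div_mul_cancel hr.ne', ENNReal.rpow_one]

theorem eLpNorm_le_of_ae_tendsto_of_eventually_mem {X G : Type*} [MeasurableSpace X]
    [NormedAddCommGroup G] {μ : Measure X} {p C : ℝ≥0∞} {F : ℕ → X → G} {f : X → G}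
    {W : ℕ → Set X} (hW : ∀ n, MeasurableSet (W n)) (hF : ∀ n, AEStronglyMeasurable (F n) μ)
    (hmem : ∀ᵐ x ∂μ, ∀ᶠ n in Filter.atTop, x ∈ W n)
    (hlim : ∀ᵐ x ∂μ, Filter.Tendsto (fun n => F n x) Filter.atTop (nhds (f x)))
    (hC : ∀ n, eLpNorm (F n) p (μ.restrict (W n)) ≤ C) : eLpNorm f p μ ≤ C := by
  have hlim' : ∀ᵐ x ∂μ,
      Filter.Tendsto (fun n => (W n).indicator (F n) x) Filter.atTop (nhds (f x)) := by
    filter_upwards [hmem, hlim] with x hx hxf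
    exact hxf.congr' (hx.mono fun n hn => (indicator_of_mem hn _).symm)
  refine (Lp.eLpNorm_lim_le_liminf_eLpNorm (fun n => (hF n).indicator (hW n)) _ hlim').trans
    (Filter.liminf_le_of_le (by isBoundedDefault) fun b hb => ?_)
  obtain ⟨n, hn⟩ := hb.exists
  exact hn.trans ((eLpNorm_indicator_eq_eLpNorm_restrict (hW n)).trans_le (hC n))

/-- The mean oscillation of `f` in `L_p`: the `L_p` norm of `f x - f y` as a function of the pair
`(x, y)`. -/
noncomputable def oscNorm {X G : Type*} [MeasurableSpace X] [NormedAddCommGroup G] (f : X → G)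
    (p : ℝ≥0∞) (μ : Measure X) : ℝ≥0∞ :=
  eLpNorm (fun w : X × X => f w.1 - f w.2) p (μ.prod μ)

theorem oscNorm_le_of_ae_tendsto_of_eventually_mem {X G : Type*} [MeasurableSpace X]
    [NormedAddCommGroup G] {μ : Measure X} [SFinite μ] {p C : ℝ≥0∞} {F : ℕ → X → G} {f : X → G}
    {W : ℕ → Set X} (hW : ∀ n, MeasurableSet (W n)) (hF : ∀ n, AEStronglyMeasurable (F n) μ)
    (hmem : ∀ᵐ x ∂μ, ∀ᶠ n in Filter.atTop, x ∈ W n)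
    (hlim : ∀ᵐ x ∂μ, Filter.Tendsto (fun n => F n x) Filter.atTop (nhds (f x)))
    (hC : ∀ n, oscNorm (F n) p (μ.restrict (W n)) ≤ C) : oscNorm f p μ ≤ C := by
  refine eLpNorm_le_of_ae_tendsto_of_eventually_mem (F := fun n w => F n w.1 - F n w.2)
    (fun n => (hW n).prod (hW n)) (fun n => (hF n).comp_fst.sub (hF n).comp_snd) ?_ ?_
    fun n => ?_
  · filter_upwards [Measure.quasiMeasurePreserving_fst.ae hmem,
      Measure.quasiMeasurePreserving_snd.ae hmem] with w h₁ h₂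
    exact (h₁.and h₂).mono fun n hn => hn
  · filter_upwards [Measure.quasiMeasurePreserving_fst.ae hlim,
      Measure.quasiMeasurePreserving_snd.ae hlim] with w h₁ h₂
    exact h₁.sub h₂
  · rw [← Measure.prod_restrict]
    exact hC n

section Segment

variable {E : Type*} [NormedAddCommGroup E] [NormedSpace ℝ E]

/-- The point `w.1.2 + w.2 • (w.1.1 - w.1.2)` of the segment between `w.1.2` and `w.1.1`, as a
function of the end points and the parameter jointly. -/
def segmentPoint (w : (E × E) × ℝ) : E :=
  AffineMap.lineMap w.1.2 w.1.1 w.2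

theorem continuous_segmentPoint : Continuous (segmentPoint (E := E)) := by
  unfold segmentPoint
  fun_prop

theorem sub_eq_integral_fderiv_segmentPoint {G : Type*} [NormedAddCommGroup G] [NormedSpace ℝ G]
    [CompleteSpace G] {F : E → G} (hF : ContDiff ℝ 1 F) (x y : E) :
    F x - F y = ∫ t in Icc (0 : ℝ) 1, fderiv ℝ F (segmentPoint ((x, y), t)) (x - y) := by
  have hderiv (t : ℝ) : HasDerivAt (fun t : ℝ => F (segmentPoint ((x, y), t)))
      (fderiv ℝ F (segmentPoint ((x, y), t)) (x - y)) t :=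
    (hF.differentiable (by simp) _).hasFDerivAt.comp_hasDerivAt t AffineMap.hasDerivAt_lineMap
  have hcont : Continuous fun t : ℝ => fderiv ℝ F (segmentPoint ((x, y), t)) (x - y) :=
    ((hF.continuous_fderiv (by simp)).comp (continuous_segmentPoint.comp (by fun_prop))).clm_apply
      continuous_const
  rw [integral_Icc_eq_integral_Ioc, ← intervalIntegral.integral_of_le zero_le_one,
    intervalIntegral.integral_eq_sub_of_hasDerivAt (fun t _ => hderiv t)
      (hcont.intervalIntegrable _ _)]
  simp [segmentPoint]

variable [FiniteDimensional ℝ E] [MeasurableSpace E] [BorelSpace E] (μ : Measure E)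
  [μ.IsAddHaarMeasure]

theorem addHaar_preimage_smul_add_le {t : ℝ} (ht : 1 / 2 ≤ t) (a : E) (A : Set E) :
    μ {x | t • x + a ∈ A} ≤ 2 ^ Module.finrank ℝ E * μ A := by
  have hpreimage : {x | t • x + a ∈ A} = (t • ·) ⁻¹' ((· + a) ⁻¹' A) := rfl
  rw [hpreimage, Measure.addHaar_preimage_smul _ (by linarith), measure_preimage_add_right]
  gcongr
  rw [ENNReal.ofReal_le_iff_le_toReal (by finiteness), abs_of_nonneg (by positivity),
    ENNReal.toReal_pow, ENNReal.toReal_ofNat, ← inv_pow]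
  gcongr
  rw [inv_le_comm₀ (by linarith) two_pos]
  linarith

variable {V A : Set E}

theorem prod_restrict_preimage_smul_add_le_of_half_le (hV : Convex ℝ V) (hVm : MeasurableSet V)
    (hA : MeasurableSet A) {t : ℝ} (ht : t ∈ Icc (1 / 2) 1) :
    ((μ.restrict V).prod (μ.restrict V)) {w | t • w.1 + (1 - t) • w.2 ∈ A} ≤
      2 ^ Module.finrank ℝ E * μ V * μ.restrict V A := by
  have hAm : MeasurableSet {w : E × E | t • w.1 + (1 - t) • w.2 ∈ A} :=
    (by fun_prop : Measurable fun w : E × E => t • w.1 + (1 - t) • w.2) hA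
  rw [Measure.prod_apply_symm hAm]
  calc ∫⁻ y in V, μ.restrict V {x | t • x + (1 - t) • y ∈ A} ∂μ
      ≤ ∫⁻ _ in V, 2 ^ Module.finrank ℝ E * μ.restrict V A ∂μ := by
        refine lintegral_mono_ae ((ae_restrict_iff' hVm).2 (.of_forall fun y hy => ?_))
        rw [Measure.restrict_apply' hVm, Measure.restrict_apply hA]
        refine (measure_mono ?_).trans
          (addHaar_preimage_smul_add_le μ ht.1 ((1 - t) • y) (A ∩ V))
        exact fun x hx => ⟨hx.1, hV hx.2 hy (by linarith [ht.1]) (by linarith [ht.2]) (by ring)⟩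
    _ = 2 ^ Module.finrank ℝ E * μ V * μ.restrict V A := by
        rw [lintegral_const, Measure.restrict_apply_univ]
        ring

theorem prod_restrict_preimage_smul_add_le (hV : Convex ℝ V) (hVm : MeasurableSet V)
    (hA : MeasurableSet A) {t : ℝ} (ht : t ∈ Icc 0 1) :
    ((μ.restrict V).prod (μ.restrict V)) {w | t • w.1 + (1 - t) • w.2 ∈ A} ≤
      2 ^ Module.finrank ℝ E * μ V * μ.restrict V A := by
  rcases le_total (1 / 2) t with h | h
  · exact prod_restrict_preimage_smul_add_le_of_half_le μ hV hVm hA ⟨h, ht.2⟩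
  · have hAm : MeasurableSet {w : E × E | t • w.1 + (1 - t) • w.2 ∈ A} :=
      (by fun_prop : Measurable fun w : E × E => t • w.1 + (1 - t) • w.2) hA
    rw [← Measure.prod_swap, Measure.map_apply measurable_swap hAm]
    convert prod_restrict_preimage_smul_add_le_of_half_le μ hV hVm hA (t := 1 - t)
      ⟨by linarith, by linarith [ht.1]⟩ using 3
    simp only [preimage_ofPred_eq, Prod.fst_swap, Prod.snd_swap, sub_sub_cancel, add_comm]

/- A uniformly distributed point of the segment between independent points of a convex set has a
bounded density: at least one of the two coefficients of the end points is `≥ 1 / 2`. -/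
theorem map_segmentPoint_le (hV : Convex ℝ V) (hVm : MeasurableSet V) :
    Measure.map segmentPoint
        (((μ.restrict V).prod (μ.restrict V)).prod (volume.restrict (Icc (0 : ℝ) 1))) ≤
      (2 ^ Module.finrank ℝ E * μ V) • μ.restrict V := by
  refine Measure.le_iff.2 fun A hA => ?_
  have hseg : Measurable (segmentPoint (E := E)) := continuous_segmentPoint.measurable
  rw [Measure.map_apply hseg hA, Measure.prod_apply_symm (hseg hA)]
  calc _ ≤ ∫⁻ _ in Icc (0 : ℝ) 1, 2 ^ Module.finrank ℝ E * μ V * μ.restrict V A := by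
        refine lintegral_mono_ae
          ((ae_restrict_iff' measurableSet_Icc).2 (.of_forall fun t ht => ?_))
        convert prod_restrict_preimage_smul_add_le μ hV hVm hA ht using 3
        simp only [segmentPoint, AffineMap.lineMap_apply_module, preimage_preimage,
          add_comm]
        rfl
    _ = _ := by simp

variable {G : Type*} [NormedAddCommGroup G] [NormedSpace ℝ G] {F : E → G} {D : ℝ≥0} {p : ℝ≥0∞}

theorem eLpNorm_fderiv_segmentPoint_le (hV : Convex ℝ V) (hVm : MeasurableSet V)
    (hD : ∀ x ∈ V, ∀ y ∈ V, ‖x - y‖ ≤ D) (hF : ContDiff ℝ 1 F) :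
    eLpNorm (fun w : (E × E) × ℝ => fderiv ℝ F (segmentPoint w) (w.1.1 - w.1.2)) p
        (((μ.restrict V).prod (μ.restrict V)).prod (volume.restrict (Icc (0 : ℝ) 1))) ≤
      D * ((2 ^ Module.finrank ℝ E * μ V) ^ (1 / p).toReal *
        eLpNorm (fderiv ℝ F) p (μ.restrict V)) := by
  have hdiam : ∀ᵐ w ∂(((μ.restrict V).prod (μ.restrict V)).prod
      (volume.restrict (Icc (0 : ℝ) 1))), ‖w.1.1 - w.1.2‖ ≤ D := by
    rw [Measure.prod_restrict, Measure.prod_restrict]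
    filter_upwards [ae_restrict_mem ((hVm.prod hVm).prod measurableSet_Icc)] with w hw
    exact hD _ hw.1.1 _ hw.1.2
  have hdensity := map_segmentPoint_le μ hV hVm
  generalize ((μ.restrict V).prod (μ.restrict V)).prod
    (volume.restrict (Icc (0 : ℝ) 1)) = ν at hdiam hdensity ⊢
  calc eLpNorm (fun w : (E × E) × ℝ => fderiv ℝ F (segmentPoint w) (w.1.1 - w.1.2)) p ν
      ≤ D • eLpNorm (fderiv ℝ F ∘ segmentPoint) p ν := by
        refine eLpNorm_le_nnreal_smul_eLpNorm_of_ae_le_mul (hdiam.mono fun w hw => ?_) p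
        rw [mul_comm]
        exact (ContinuousLinearMap.le_opNorm _ _).trans
          (mul_le_mul_of_nonneg_left hw (norm_nonneg _))
    _ = D * eLpNorm (fderiv ℝ F) p (Measure.map segmentPoint ν) := by
        rw [eLpNorm_map_measure (hF.continuous_fderiv (by simp)).aestronglyMeasurable
          continuous_segmentPoint.aemeasurable, ENNReal.smul_def, smul_eq_mul]
    _ ≤ _ := by
        gcongr
        exact eLpNorm_le_of_measure_le_smul hdensity

theorem oscNorm_le_eLpNorm_fderiv [CompleteSpace G] (hV : Convex ℝ V) (hVm : MeasurableSet V)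
    (hD : ∀ x ∈ V, ∀ y ∈ V, ‖x - y‖ ≤ D) (hp : 1 ≤ p) (hF : ContDiff ℝ 1 F) :
    oscNorm F p (μ.restrict V) ≤ D * ((2 ^ Module.finrank ℝ E * μ V) ^ (1 / p).toReal *
      eLpNorm (fderiv ℝ F) p (μ.restrict V)) := by
  have : IsProbabilityMeasure (volume.restrict (Icc (0 : ℝ) 1)) := ⟨by simp⟩
  have hcont : Continuous fun w : (E × E) × ℝ =>
      fderiv ℝ F (segmentPoint w) (w.1.1 - w.1.2) :=
    ((hF.continuous_fderiv (by simp)).comp continuous_segmentPoint).clm_apply (by fun_prop)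
  simp only [oscNorm, sub_eq_integral_fderiv_segmentPoint hF]
  exact (eLpNorm_integral_prod_le hp hcont.aestronglyMeasurable).trans
    (eLpNorm_fderiv_segmentPoint_le μ hV hVm hD hF)

end Segment

section Mollification

variable {E : Type*} [NormedAddCommGroup E] [NormedSpace ℝ E] [FiniteDimensional ℝ E]
  [MeasurableSpace E] [BorelSpace E] (μ : Measure E) [μ.IsAddHaarMeasure]
  (φ : ContDiffBump (0 : E)) {f g : E → ℝ}

open scoped Convolution in
/-- The mollification of `f` with a normalized bump function, a smooth approximation of `f`. -/
noncomputable def mollify (f : E → ℝ) : E → ℝ :=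
  f ⋆[ContinuousLinearMap.mul ℝ ℝ, μ] φ.normed μ

theorem mollify_eq_integral_sub_mul (f : E → ℝ) (x : E) :
    mollify μ φ f x = ∫ t, f (x - t) * φ.normed μ t ∂μ := by
  rw [mollify, convolution_eq_swap]
  simp

theorem contDiff_mollify (hf : LocallyIntegrable f μ) : ContDiff ℝ 1 (mollify μ φ f) :=
  φ.hasCompactSupport_normed.contDiff_convolution_right _ hf φ.contDiff_normed

theorem ae_tendsto_mollify {φ : ℕ → ContDiffBump (0 : E)} {K : ℝ}
    (hφ : Filter.Tendsto (fun n => (φ n).rOut) Filter.atTop (nhds 0))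
    (hK : ∀ n, (φ n).rOut ≤ K * (φ n).rIn) (hf : LocallyIntegrable f μ) :
    ∀ᵐ x ∂μ, Filter.Tendsto (fun n => mollify μ (φ n) f x) Filter.atTop (nhds (f x)) := by
  filter_upwards [ContDiffBump.ae_convolution_tendsto_right_of_locallyIntegrable hφ
    (.of_forall hK) hf] with x hx
  refine hx.congr fun n => ?_
  rw [mollify_eq_integral_sub_mul]
  simp only [convolution, ContinuousLinearMap.lsmul_apply, smul_eq_mul, mul_comm]

theorem isProbabilityMeasure_withDensity_normed :
    IsProbabilityMeasure (μ.withDensity fun t => ENNReal.ofReal (φ.normed μ t)) := by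
  refine ⟨?_⟩
  rw [withDensity_apply _ MeasurableSet.univ, Measure.restrict_univ,
    ← ofReal_integral_eq_lintegral_ofReal φ.integrable_normed (.of_forall φ.nonneg_normed),
    φ.integral_normed, ENNReal.ofReal_one]

theorem map_sub_prod_eq (κ : Measure E) [IsProbabilityMeasure κ] :
    Measure.map (fun w : E × E => w.1 - w.2) (μ.prod κ) = μ := by
  have hsub : Measurable fun w : E × E => w.1 - w.2 := measurable_fst.sub measurable_snd
  ext A hA
  have translate (t : E) :
      μ ((fun x => (x, t)) ⁻¹' ((fun w : E × E => w.1 - w.2) ⁻¹' A)) = μ A := by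
    change μ ((fun x => x - t) ⁻¹' A) = μ A
    simpa only [← sub_eq_add_neg] using measure_preimage_add_right μ (-t) A
  rw [Measure.map_apply hsub hA, Measure.prod_apply_symm (hsub hA)]
  simp [translate]

theorem eLpNorm_mollify_le (hf : AEStronglyMeasurable f μ) {p : ℝ≥0∞} (hp : 1 ≤ p) :
    eLpNorm (mollify μ φ f) p μ ≤ eLpNorm f p μ := by
  set κ := μ.withDensity fun t => ENNReal.ofReal (φ.normed μ t) with hκ
  have : IsProbabilityMeasure κ := isProbabilityMeasure_withDensity_normed μ φ
  have hmap : Measure.map (fun w : E × E => w.1 - w.2) (μ.prod κ) = μ := map_sub_prod_eq μ κ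
  have hsub : Measurable fun w : E × E => w.1 - w.2 := measurable_fst.sub measurable_snd
  have hf' : AEStronglyMeasurable f (Measure.map (fun w : E × E => w.1 - w.2) (μ.prod κ)) := by
    rwa [hmap]
  have average : mollify μ φ f = fun x => ∫ t, f (x - t) ∂κ := by
    funext x
    rw [mollify_eq_integral_sub_mul, hκ, integral_withDensity_eq_integral_toReal_smul
      φ.continuous_normed.measurable.ennreal_ofReal (by simp)]
    refine integral_congr_ae (.of_forall fun t => ?_)
    simp [ENNReal.toReal_ofReal (φ.nonneg_normed t), mul_comm]
  calc eLpNorm (mollify μ φ f) p μ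
      ≤ eLpNorm (f ∘ fun w : E × E => w.1 - w.2) p (μ.prod κ) := by
        rw [average]
        exact eLpNorm_integral_prod_le (H := f ∘ fun w : E × E => w.1 - w.2) hp
          (hf'.comp_measurable hsub)
    _ = eLpNorm f p μ := by rw [← eLpNorm_map_measure hf' hsub.aemeasurable, hmap]

/-- `g` is the weak derivative of `f` in the direction `e` on `Ω`, with the test functions of
`HasWeakDeriv`. -/
def HasWeakDirDeriv (Ω : Set E) (e : E) (f g : E → ℝ) : Prop :=
  ∀ ψ : E → ℝ, ContDiff ℝ ∞ ψ → HasCompactSupport ψ → tsupport ψ ⊆ Ω →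
    ∫ z in Ω, f z * dirDeriv e ψ z ∂μ = -∫ z in Ω, g z * ψ z ∂μ

theorem dirDeriv_mollify (hf : LocallyIntegrable f μ) (e x : E) :
    dirDeriv e (mollify μ φ f) x = ∫ t, f t * dirDeriv e (φ.normed μ) (x - t) ∂μ := by
  have hφ : ContDiff ℝ 1 (φ.normed μ) := φ.contDiff_normed
  have hφc : HasCompactSupport (φ.normed μ) := φ.hasCompactSupport_normed
  have hex := (hφc.fderiv ℝ).convolutionExists_right
    ((ContinuousLinearMap.mul ℝ ℝ).precompR E) hf (hφ.continuous_fderiv (by simp)) x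
  rw [dirDeriv, mollify, (hφc.hasFDerivAt_convolution_right _ hf hφ x).fderiv, convolution_def,
    ContinuousLinearMap.integral_apply hex]
  rfl

theorem tsupport_normed_const_sub_subset (x : E) :
    tsupport (fun t => φ.normed μ (x - t)) ⊆ Metric.closedBall x φ.rOut := by
  refine closure_minimal (fun t ht => ?_) Metric.isClosed_closedBall
  have hxt : x - t ∈ Function.support (φ.normed μ) := ht
  rw [φ.support_normed_eq, mem_ball_zero_iff] at hxt
  rw [mem_closedBall_iff_norm, norm_sub_rev]
  exact hxt.le

theorem dirDeriv_mollify_indicator {Ω : Set E} (hΩ : MeasurableSet Ω) {e : E}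
    (hf : IntegrableOn f Ω μ) (h : HasWeakDirDeriv μ Ω e f g) {x : E}
    (hx : Metric.closedBall x φ.rOut ⊆ Ω) :
    dirDeriv e (mollify μ φ (Ω.indicator f)) x = mollify μ φ (Ω.indicator g) x := by
  have hφ : ContDiff ℝ ∞ (φ.normed μ) := φ.contDiff_normed
  have hsupp := tsupport_normed_const_sub_subset μ φ x
  have integral_indicator_mul (k θ : E → ℝ) :
      ∫ t, Ω.indicator k t * θ t ∂μ = ∫ t in Ω, k t * θ t ∂μ := by
    rw [← integral_indicator hΩ]
    simp only [indicator_mul_left]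
  have by_parts := h (fun t => φ.normed μ (x - t)) (hφ.comp (contDiff_const.sub contDiff_id))
    ((isCompact_closedBall x φ.rOut).of_isClosed_subset (isClosed_tsupport _) hsupp)
    (hsupp.trans hx)
  simp only [dirDeriv_comp_const_sub (hφ.differentiable (by simp)), mul_neg, integral_neg,
    neg_inj] at by_parts
  rw [dirDeriv_mollify μ φ ((integrable_indicator_iff hΩ).2 hf).locallyIntegrable,
    integral_indicator_mul, by_parts, ← integral_indicator_mul]
  rfl

theorem eLpNorm_dirDeriv_mollify_indicator_le {Ω W : Set E} (hΩ : MeasurableSet Ω)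
    (hW : MeasurableSet W) {e : E} (hf : IntegrableOn f Ω μ)
    (hg : AEStronglyMeasurable g (μ.restrict Ω)) (h : HasWeakDirDeriv μ Ω e f g)
    (hWΩ : ∀ x ∈ W, Metric.closedBall x φ.rOut ⊆ Ω) {p : ℝ≥0∞} (hp : 1 ≤ p) :
    eLpNorm (dirDeriv e (mollify μ φ (Ω.indicator f))) p (μ.restrict W) ≤
      eLpNorm g p (μ.restrict Ω) := by
  calc eLpNorm (dirDeriv e (mollify μ φ (Ω.indicator f))) p (μ.restrict W)
      = eLpNorm (mollify μ φ (Ω.indicator g)) p (μ.restrict W) :=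
        eLpNorm_congr_ae ((ae_restrict_iff' hW).2 (.of_forall fun x hx =>
          dirDeriv_mollify_indicator μ φ hΩ hf h (hWΩ x hx)))
    _ ≤ eLpNorm (mollify μ φ (Ω.indicator g)) p μ := eLpNorm_restrict_le _ _ _ _
    _ ≤ eLpNorm (Ω.indicator g) p μ :=
        eLpNorm_mollify_le μ φ ((aestronglyMeasurable_indicator_iff hΩ).2 hg) hp
    _ = eLpNorm g p (μ.restrict Ω) := eLpNorm_indicator_eq_eLpNorm_restrict hΩ

end Mollification

section InnerSet

variable {E : Type*} [NormedAddCommGroup E] {V : Set E} {r : ℝ}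

/-- The points of `V` at distance more than `r` from the complement; mollification with radius `r`
commutes with weak derivatives there. -/
def innerSet (V : Set E) (r : ℝ) : Set E :=
  {x | Metric.closedBall x r ⊆ V}

theorem innerSet_subset (hr : 0 ≤ r) : innerSet V r ⊆ V :=
  fun _ hx => hx (Metric.mem_closedBall_self hr)

theorem convex_innerSet [NormedSpace ℝ E] (hV : Convex ℝ V) (r : ℝ) : Convex ℝ (innerSet V r) := by
  have translates : innerSet V r = ⋂ v ∈ Metric.closedBall (0 : E) r, (fun x => v + x) ⁻¹' V := by
    ext x
    simp only [innerSet, mem_ofPred_eq, mem_iInter₂, mem_preimage, subset_def,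
      mem_closedBall_iff_norm, sub_zero]
    exact ⟨fun hx v hv => hx _ (by simpa using hv), fun hx z hz => by simpa using hx (z - x) hz⟩
  rw [translates]
  exact convex_iInter₂ fun v _ => hV.translate_preimage_right v

theorem isOpen_innerSet [NormedSpace ℝ E] [FiniteDimensional ℝ E] (hV : IsOpen V) (hr : 0 ≤ r) :
    IsOpen (innerSet V r) := by
  have compl_thickening : innerSet V r = (Metric.cthickening r Vᶜ)ᶜ := by
    ext x
    rw [hV.isClosed_compl.cthickening_eq_biUnion_closedBall hr]
    simp only [innerSet, mem_ofPred_eq, subset_def, mem_compl_iff, mem_iUnion, not_exists,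
      Metric.mem_closedBall, dist_comm x]
    exact forall_congr' fun z => not_imp_not.symm
  rw [compl_thickening]
  exact Metric.isClosed_cthickening.isOpen_compl

theorem eventually_mem_innerSet (hV : IsOpen V) {x : E} (hx : x ∈ V) {r : ℕ → ℝ}
    (hr : Filter.Tendsto r Filter.atTop (nhds 0)) : ∀ᶠ n in Filter.atTop, x ∈ innerSet V (r n) :=
  hr.eventually (eventually_closedBall_subset (hV.mem_nhds hx))

end InnerSet

theorem exists_contDiffBump_seq (E : Type*) [NormedAddCommGroup E] :
    ∃ φ : ℕ → ContDiffBump (0 : E),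
      Filter.Tendsto (fun n => (φ n).rOut) Filter.atTop (nhds 0) ∧
        ∀ n, (φ n).rOut ≤ 2 * (φ n).rIn := by
  refine ⟨fun n => ⟨1 / (n + 1) / 2, 1 / (n + 1), by positivity, half_lt_self (by positivity)⟩,
    tendsto_one_div_add_atTop_nhds_zero_nat, fun n => ?_⟩
  exact (mul_div_cancel₀ _ two_ne_zero).ge

theorem norm_le_norm_apply_add_norm_apply {G : Type*} [NormedAddCommGroup G] [NormedSpace ℝ G]
    (A : ℝ × ℝ →L[ℝ] G) : ‖A‖ ≤ ‖A (1, 0)‖ + ‖A (0, 1)‖ := by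
  refine A.opNorm_le_bound (by positivity) fun v => ?_
  have hv : A v = v.1 • A (1, 0) + v.2 • A (0, 1) := by
    rw [← map_smul, ← map_smul, ← map_add]
    simp
  calc ‖A v‖ ≤ ‖v.1‖ * ‖A (1, 0)‖ + ‖v.2‖ * ‖A (0, 1)‖ := by
        rw [hv, ← norm_smul, ← norm_smul]
        exact norm_add_le _ _
    _ ≤ ‖v‖ * ‖A (1, 0)‖ + ‖v‖ * ‖A (0, 1)‖ := by
        gcongr
        exacts [norm_fst_le v, norm_snd_le v]
    _ = (‖A (1, 0)‖ + ‖A (0, 1)‖) * ‖v‖ := by ring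

theorem eLpNorm_fderiv_le {F : ℝ × ℝ → ℝ} (hF : ContDiff ℝ 1 F) {p : ℝ≥0∞} (hp : 1 ≤ p)
    (μ : Measure (ℝ × ℝ)) :
    eLpNorm (fderiv ℝ F) p μ ≤
      eLpNorm (dirDeriv (1, 0) F) p μ + eLpNorm (dirDeriv (0, 1) F) p μ := by
  have hcont (e : ℝ × ℝ) : AEStronglyMeasurable (fun x => ‖dirDeriv e F x‖) μ :=
    ((hF.continuous_fderiv (by simp)).clm_apply continuous_const).norm.aestronglyMeasurable
  refine (eLpNorm_mono_real fun x => norm_le_norm_apply_add_norm_apply _).trans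
    ((eLpNorm_add_le (hcont (1, 0)) (hcont (0, 1)) hp).trans_eq ?_)
  rw [eLpNorm_norm, eLpNorm_norm]

theorem HasWeakDeriv.hasWeakDirDeriv_fst {Ω : Set (ℝ × ℝ)} {f g : L1 Ω}
    (h : HasWeakDeriv Ω (1, 0) f g) : HasWeakDirDeriv volume Ω (1, 0) f g := by
  intro ψ hψ hc hs
  simpa [classicalDeriv, dirDeriv] using h ψ hψ hc hs

theorem HasWeakDeriv.hasWeakDirDeriv_snd {Ω : Set (ℝ × ℝ)} {f g : L1 Ω}
    (h : HasWeakDeriv Ω (0, 1) f g) : HasWeakDirDeriv volume Ω (0, 1) f g := by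
  intro ψ hψ hc hs
  simpa [classicalDeriv, dirDeriv] using h ψ hψ hc hs

theorem oscNorm_mollify_indicator_le {Ω V : Set (ℝ × ℝ)} (hΩ : MeasurableSet Ω) (hVo : IsOpen V)
    (hV : Convex ℝ V) (hVΩ : V ⊆ Ω) {D : ℝ≥0} (hD : ∀ x ∈ V, ∀ y ∈ V, ‖x - y‖ ≤ D) {p : ℝ≥0∞}
    (hp : 1 ≤ p) {f g₁ g₂ : L1 Ω} (h₁ : HasWeakDeriv Ω (1, 0) f g₁)
    (h₂ : HasWeakDeriv Ω (0, 1) f g₂) (φ : ContDiffBump (0 : ℝ × ℝ)) :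
    oscNorm (mollify volume φ (Ω.indicator f)) p (volume.restrict (innerSet V φ.rOut)) ≤
      D * ((2 ^ Module.finrank ℝ (ℝ × ℝ) * volume V) ^ (1 / p).toReal *
        (eLpNorm g₁ p (volume.restrict Ω) + eLpNorm g₂ p (volume.restrict Ω))) := by
  have hW : MeasurableSet (innerSet V φ.rOut) :=
    (isOpen_innerSet hVo φ.rOut_pos.le).measurableSet
  have hWV : innerSet V φ.rOut ⊆ V := innerSet_subset φ.rOut_pos.le
  have hf : IntegrableOn f Ω := L1.integrable_coeFn f
  have hF := contDiff_mollify volume φ ((integrable_indicator_iff hΩ).2 hf).locallyIntegrable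
  refine (oscNorm_le_eLpNorm_fderiv volume (convex_innerSet hV _) hW
    (fun x hx y hy => hD x (hWV hx) y (hWV hy)) hp hF).trans ?_
  gcongr
  refine (eLpNorm_fderiv_le hF hp _).trans (add_le_add ?_ ?_)
  · exact eLpNorm_dirDeriv_mollify_indicator_le volume φ hΩ hW hf (Lp.aestronglyMeasurable g₁)
      h₁.hasWeakDirDeriv_fst (fun x hx => hx.trans hVΩ) hp
  · exact eLpNorm_dirDeriv_mollify_indicator_le volume φ hΩ hW hf (Lp.aestronglyMeasurable g₂)
      h₂.hasWeakDirDeriv_snd (fun x hx => hx.trans hVΩ) hp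

theorem oscNorm_le_of_convex {Ω V : Set (ℝ × ℝ)} (hΩ : MeasurableSet Ω) (hVo : IsOpen V)
    (hV : Convex ℝ V) (hVΩ : V ⊆ Ω) {D : ℝ≥0} (hD : ∀ x ∈ V, ∀ y ∈ V, ‖x - y‖ ≤ D) {p : ℝ≥0∞}
    (hp : 1 ≤ p) {f g₁ g₂ : L1 Ω} (h₁ : HasWeakDeriv Ω (1, 0) f g₁)
    (h₂ : HasWeakDeriv Ω (0, 1) f g₂) :
    oscNorm f p (volume.restrict V) ≤
      D * ((2 ^ Module.finrank ℝ (ℝ × ℝ) * volume V) ^ (1 / p).toReal *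
        (eLpNorm g₁ p (volume.restrict Ω) + eLpNorm g₂ p (volume.restrict Ω))) := by
  obtain ⟨φ, hφ, hφK⟩ := exists_contDiffBump_seq (ℝ × ℝ)
  have hf : LocallyIntegrable (Ω.indicator f) volume :=
    ((integrable_indicator_iff hΩ).2 (L1.integrable_coeFn f)).locallyIntegrable
  have hW (n : ℕ) : MeasurableSet (innerSet V (φ n).rOut) :=
    (isOpen_innerSet hVo (φ n).rOut_pos.le).measurableSet
  have hlim : ∀ᵐ x ∂(volume.restrict V), Filter.Tendsto
      (fun n => mollify volume (φ n) (Ω.indicator f) x) Filter.atTop (nhds (f x)) := by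
    refine (ae_restrict_iff' hVo.measurableSet).2 ?_
    filter_upwards [ae_tendsto_mollify volume hφ hφK hf] with x hx hxV
    rwa [indicator_of_mem (hVΩ hxV)] at hx
  have hmem : ∀ᵐ x ∂(volume.restrict V), ∀ᶠ n in Filter.atTop, x ∈ innerSet V (φ n).rOut :=
    (ae_restrict_mem hVo.measurableSet).mono fun x hx => eventually_mem_innerSet hVo hx hφ
  refine oscNorm_le_of_ae_tendsto_of_eventually_mem hW
    (fun n => (contDiff_mollify volume (φ n) hf).continuous.aestronglyMeasurable) hmem hlim
    fun n => ?_
  rw [Measure.restrict_restrict (hW n), inter_eq_left.2 (innerSet_subset (φ n).rOut_pos.le)]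
  exact oscNorm_mollify_indicator_le hΩ hVo hV hVΩ hD hp h₁ h₂ (φ n)

/-! ### Domination up to a constant -/

section Domination

variable {ι : Type*} {s : Set ι} {f g h : ι → ℝ≥0∞}

/-- `f` is dominated by `g` on `s`: there is one finite constant `C` with `f i ≤ C * g i` for all
`i ∈ s`. All constants of the error estimates are hidden in this relation. -/
def DominatedOn (s : Set ι) (f g : ι → ℝ≥0∞) : Prop :=
  ∃ C : ℝ≥0, ∀ i ∈ s, f i ≤ C * g i

namespace DominatedOn

theorem of_le_mul {C : ℝ≥0∞} (hC : C ≠ ⊤) (h : ∀ i ∈ s, f i ≤ C * g i) : DominatedOn s f g :=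
  ⟨C.toNNReal, by rwa [ENNReal.coe_toNNReal hC]⟩

theorem of_le (h : ∀ i ∈ s, f i ≤ g i) : DominatedOn s f g :=
  of_le_mul ENNReal.one_ne_top (by simpa using h)

theorem of_le_mul_of_ne_top {C : ℝ≥0∞} (hC : C ≠ ⊤)
    (h : ∀ i ∈ s, g i ≠ ⊤ → f i ≤ C * g i) : DominatedOn s f g := by
  refine of_le_mul (C := C + 1) (by finiteness) fun i hi => ?_
  by_cases hg : g i = ⊤
  · simp [hg]
  · exact (h i hi hg).trans (by gcongr; exact le_self_add)

theorem trans (hf : DominatedOn s f g) (hg : DominatedOn s g h) : DominatedOn s f h := by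
  obtain ⟨C, hC⟩ := hf
  obtain ⟨D, hD⟩ := hg
  refine ⟨C * D, fun i hi => (hC i hi).trans ?_⟩
  rw [ENNReal.coe_mul, mul_assoc]
  gcongr
  exact hD i hi

theorem add (hf : DominatedOn s f h) (hg : DominatedOn s g h) :
    DominatedOn s (fun i => f i + g i) h := by
  obtain ⟨C, hC⟩ := hf
  obtain ⟨D, hD⟩ := hg
  refine ⟨C + D, fun i hi => ?_⟩
  rw [ENNReal.coe_add, add_mul]
  exact add_le_add (hC i hi) (hD i hi)

theorem sum {κ : Type*} {t : Finset κ} {f : κ → ι → ℝ≥0∞}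
    (hf : ∀ k ∈ t, DominatedOn s (f k) g) : DominatedOn s (fun i => ∑ k ∈ t, f k i) g := by
  choose! C hC using hf
  refine ⟨∑ k ∈ t, C k, fun i hi => ?_⟩
  rw [ENNReal.ofNNReal_finsetSum, Finset.sum_mul]
  exact Finset.sum_le_sum fun k hk => hC k hk i hi

theorem const_mul {K : ℝ≥0∞} (hK : K ≠ ⊤) (hf : DominatedOn s f g) :
    DominatedOn s (fun i => K * f i) g :=
  (of_le_mul hK fun _ _ => le_rfl).trans hf

theorem comp {κ : Type*} {t : Set κ} {φ : κ → ι} (hf : DominatedOn s f g) (hφ : MapsTo φ t s) :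
    DominatedOn t (fun k => f (φ k)) (fun k => g (φ k)) :=
  hf.imp fun _ hC k hk => hC (φ k) (hφ hk)

end DominatedOn

end Domination

/-! ### Distance to the constants -/

section ConstDist

variable {X G : Type*} [MeasurableSpace X] {μ : Measure X} [NormedAddCommGroup G]
  {p : ℝ≥0∞} {f : X → G}

/-- The `L_p` distance of `f` to the constant functions, which is bounded by the gradient of `f`
in the Poincaré inequality. -/
noncomputable def constDist (f : X → G) (p : ℝ≥0∞) (μ : Measure X) : ℝ≥0∞ :=
  ⨅ c : G, eLpNorm (fun x => f x - c) p μ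

theorem constDist_mono_measure (f : X → G) (p : ℝ≥0∞) {ν : Measure X} (h : ν ≤ μ) :
    constDist f p ν ≤ constDist f p μ :=
  iInf_mono fun _ => eLpNorm_mono_measure _ h

theorem constDist_le_mul_oscNorm [NormedSpace ℝ G] [CompleteSpace G] [IsFiniteMeasure μ]
    (hμ : μ ≠ 0) (hp : 1 ≤ p) (hf : Integrable f μ) :
    constDist f p μ ≤ (μ univ)⁻¹ ^ (1 / p).toReal * oscNorm f p μ := by
  have hμ0 : μ univ ≠ 0 := by simpa using hμ
  set κ := (μ univ)⁻¹ • μ with hκ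
  have : IsProbabilityMeasure κ := ⟨by simp [hκ, ENNReal.inv_mul_cancel hμ0]⟩
  have hfκ : Integrable f κ := hf.smul_measure (by simpa using hμ0)
  have hmean (x : X) : f x - ∫ y, f y ∂κ = ∫ y, (f x - f y) ∂κ := by
    rw [integral_sub (integrable_const _) hfκ, integral_const, probReal_univ, one_smul]
  calc constDist f p μ ≤ eLpNorm (fun x => f x - ∫ y, f y ∂κ) p μ := iInf_le _ _
    _ = eLpNorm (fun x => ∫ y, (f x - f y) ∂κ) p μ := by simp only [hmean]
    _ ≤ eLpNorm (fun w : X × X => f w.1 - f w.2) p (μ.prod κ) :=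
        eLpNorm_integral_prod_le hp (H := fun w : X × X => f w.1 - f w.2)
          (hf.aestronglyMeasurable.comp_fst.sub hfκ.aestronglyMeasurable.comp_snd)
    _ ≤ _ := by
        rw [hκ, Measure.prod_smul_right]
        exact eLpNorm_smul_measure_le _ _ _ _

theorem eLpNorm_restrict_union_le {V W : Set X} (hV : MeasurableSet V) (hp : 1 ≤ p)
    (hf : AEStronglyMeasurable f (μ.restrict (V ∪ W))) :
    eLpNorm f p (μ.restrict (V ∪ W)) ≤
      eLpNorm f p (μ.restrict V) + eLpNorm f p (μ.restrict W) := by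
  calc eLpNorm f p (μ.restrict (V ∪ W))
      = eLpNorm (V.indicator f + Vᶜ.indicator f) p (μ.restrict (V ∪ W)) := by
        rw [indicator_self_add_compl]
    _ ≤ eLpNorm (V.indicator f) p (μ.restrict (V ∪ W)) +
        eLpNorm (Vᶜ.indicator f) p (μ.restrict (V ∪ W)) :=
        eLpNorm_add_le (hf.indicator hV) (hf.indicator hV.compl) hp
    _ ≤ _ := by
        rw [eLpNorm_indicator_eq_eLpNorm_restrict hV, Measure.restrict_restrict hV,
          eLpNorm_indicator_eq_eLpNorm_restrict hV.compl, Measure.restrict_restrict hV.compl]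
        gcongr
        · exact inter_subset_left
        · exact fun x hx => hx.2.resolve_left hx.1

theorem eLpNorm_const_restrict_eq_mul {V W : Set X} (c : G) (hp : p ≠ 0) (hVW : V ⊆ W)
    (hV : μ V ≠ 0) (hW : μ W ≠ ⊤) :
    eLpNorm (fun _ => c) p (μ.restrict W) =
      (μ W / μ V) ^ (1 / p.toReal) * eLpNorm (fun _ => c) p (μ.restrict V) := by
  have hV' : μ V ≠ ⊤ := measure_ne_top_of_subset hVW hW
  have hW0 : μ W ≠ 0 := fun h => hV (measure_mono_null hVW h)
  rw [eLpNorm_const c hp (by simpa using hW0), eLpNorm_const c hp (by simpa using hV),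
    Measure.restrict_apply_univ, Measure.restrict_apply_univ, mul_left_comm,
    ← ENNReal.mul_rpow_of_nonneg _ _ (by positivity), ENNReal.div_mul_cancel hV hV']

theorem eLpNorm_sub_const_restrict_le {V W : Set X} (hW : μ W ≠ ⊤) (hVW : μ (V ∩ W) ≠ 0)
    (hp : 1 ≤ p) (hfV : AEStronglyMeasurable f (μ.restrict V))
    (hfW : AEStronglyMeasurable f (μ.restrict W)) (c d : G) :
    eLpNorm (fun x => f x - c) p (μ.restrict W) ≤
      eLpNorm (fun x => f x - d) p (μ.restrict W) + (μ W / μ (V ∩ W)) ^ (1 / p.toReal) *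
        (eLpNorm (fun x => f x - c) p (μ.restrict V) +
          eLpNorm (fun x => f x - d) p (μ.restrict W)) := by
  have hVWV : μ.restrict (V ∩ W) ≤ μ.restrict V := Measure.restrict_mono inter_subset_left le_rfl
  have hVWW : μ.restrict (V ∩ W) ≤ μ.restrict W := Measure.restrict_mono inter_subset_right le_rfl
  have hdiff : eLpNorm (fun _ => d - c) p (μ.restrict (V ∩ W)) ≤
      eLpNorm (fun x => f x - c) p (μ.restrict V) +
        eLpNorm (fun x => f x - d) p (μ.restrict W) := by
    have h : (fun _ => d - c) = (fun x => f x - c) - fun x => f x - d := by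
      funext x; simp
    rw [h]
    refine (eLpNorm_sub_le ((hfV.mono_measure hVWV).sub aestronglyMeasurable_const)
      ((hfW.mono_measure hVWW).sub aestronglyMeasurable_const) hp).trans ?_
    exact add_le_add (eLpNorm_mono_measure _ hVWV) (eLpNorm_mono_measure _ hVWW)
  have h : (fun x => f x - c) = (fun x => f x - d) + fun _ => d - c := by
    funext x; simp
  calc eLpNorm (fun x => f x - c) p (μ.restrict W)
      ≤ eLpNorm (fun x => f x - d) p (μ.restrict W) +
          eLpNorm (fun _ => d - c) p (μ.restrict W) := by
        rw [h]
        exact eLpNorm_add_le (hfW.sub aestronglyMeasurable_const) aestronglyMeasurable_const hp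
    _ ≤ _ := by
        rw [eLpNorm_const_restrict_eq_mul _ (zero_lt_one.trans_le hp).ne' inter_subset_right
          hVW hW]
        gcongr

theorem constDist_union_le {V W : Set X} (hVm : MeasurableSet V) (hW : μ W ≠ ⊤)
    (hVW : μ (V ∩ W) ≠ 0) (hp : 1 ≤ p) (hf : AEStronglyMeasurable f (μ.restrict (V ∪ W))) :
    constDist f p (μ.restrict (V ∪ W)) ≤
      (1 + (μ W / μ (V ∩ W)) ^ (1 / p.toReal)) *
        (constDist f p (μ.restrict V) + constDist f p (μ.restrict W)) := by
  set ρ := (μ W / μ (V ∩ W)) ^ (1 / p.toReal)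
  have hρt : ρ ≠ ⊤ := ENNReal.rpow_ne_top_of_nonneg (by positivity) (ENNReal.div_ne_top hW hVW)
  set N : G → Set X → ℝ≥0∞ := fun c U => eLpNorm (fun x => f x - c) p (μ.restrict U)
  have hfU {U : Set X} (hU : U ⊆ V ∪ W) : AEStronglyMeasurable f (μ.restrict U) :=
    hf.mono_measure (Measure.restrict_mono hU le_rfl)
  rw [constDist.eq_def f p (μ.restrict V), constDist.eq_def f p (μ.restrict W), mul_add,
    ENNReal.mul_iInf fun h => absurd h (by finiteness),
    ENNReal.mul_iInf fun h => absurd h (by finiteness)]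
  refine ENNReal.le_iInf_add_iInf fun c d => ?_
  calc constDist f p (μ.restrict (V ∪ W)) ≤ N c (V ∪ W) := iInf_le _ c
    _ ≤ N c V + N c W :=
        eLpNorm_restrict_union_le hVm hp (hf.sub aestronglyMeasurable_const)
    _ ≤ N c V + (N d W + ρ * (N c V + N d W)) := by
        gcongr
        exact eLpNorm_sub_const_restrict_le hW hVW hp (hfU subset_union_left)
          (hfU subset_union_right) c d
    _ = (1 + ρ) * N c V + (1 + ρ) * N d W := by ring

theorem dominatedOn_enorm_integral_smul [NormedSpace ℝ G] [IsFiniteMeasure μ] (hp : 1 ≤ p)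
    {φ : X → ℝ} {B : ℝ≥0} (hB : ∀ x, ‖φ x‖ ≤ B) :
    DominatedOn {f : X → G | AEStronglyMeasurable f μ} (fun f => ‖∫ x, φ x • f x ∂μ‖ₑ)
      (fun f => eLpNorm f p μ) := by
  set r : ℝ := 1 / (1 : ℝ≥0∞).toReal - 1 / p.toReal with hr
  have hr0 : 0 ≤ r := by
    rcases eq_or_ne p ⊤ with rfl | hpt
    · simp [hr]
    · have : 1 ≤ p.toReal := by simpa using ENNReal.toReal_mono hpt hp
      simpa [hr] using inv_le_one_of_one_le₀ this
  have hrt : μ univ ^ r ≠ ⊤ := ENNReal.rpow_ne_top_of_nonneg hr0 (by finiteness)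
  refine .of_le_mul (C := B * μ univ ^ r) (by finiteness)
    fun f (hf : AEStronglyMeasurable f μ) => ?_
  calc ‖∫ x, φ x • f x ∂μ‖ₑ ≤ ∫⁻ x, ‖φ x • f x‖ₑ ∂μ := enorm_integral_le_lintegral_enorm _
    _ ≤ ∫⁻ x, B * ‖f x‖ₑ ∂μ := by
        refine lintegral_mono fun x => ?_
        rw [enorm_smul]
        gcongr
        exact enorm_le_coe.2 (hB x)
    _ = B * eLpNorm f 1 μ := by
        rw [lintegral_const_mul' _ _ ENNReal.coe_ne_top, eLpNorm_one_eq_lintegral_enorm]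
    _ ≤ B * (eLpNorm f p μ * μ univ ^ r) := by
        gcongr
        exact eLpNorm_le_eLpNorm_mul_rpow_measure_univ hp hf
    _ = B * μ univ ^ r * eLpNorm f p μ := by ring

theorem enorm_integral_mul_enorm_le [NormedSpace ℝ G] [CompleteSpace G] [IsFiniteMeasure μ]
    {φ : X → ℝ} (hφ : AEStronglyMeasurable φ μ) {B : ℝ≥0} (hB : ∀ x, ‖φ x‖ ≤ B)
    (hf : Integrable f μ) (c : G) :
    ‖∫ x, φ x ∂μ‖ₑ * ‖c‖ₑ ≤
      ‖∫ x, φ x • f x ∂μ‖ₑ + ‖∫ x, φ x • (f x - c) ∂μ‖ₑ := by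
  have hφi : Integrable φ μ := .of_bound hφ B (.of_forall hB)
  have hφf : Integrable (fun x => φ x • f x) μ := hf.bdd_smul B hφ (.of_forall hB)
  have h : (∫ x, φ x ∂μ) • c = (∫ x, φ x • f x ∂μ) - ∫ x, φ x • (f x - c) ∂μ := by
    simp only [smul_sub]
    rw [integral_sub hφf (hφi.smul_const c), integral_smul_const, sub_sub_cancel]
  rw [← enorm_smul, h]
  exact enorm_sub_le

theorem dominatedOn_eLpNorm_of_integral_ne_zero [NormedSpace ℝ G] [CompleteSpace G]
    [IsFiniteMeasure μ] (hp : 1 ≤ p) {φ : X → ℝ} (hφ : AEStronglyMeasurable φ μ) {B : ℝ≥0}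
    (hB : ∀ x, ‖φ x‖ ≤ B) (h0 : ∫ x, φ x ∂μ ≠ 0) :
    DominatedOn {f : X → G | Integrable f μ} (fun f => eLpNorm f p μ)
      (fun f => ‖∫ x, φ x • f x ∂μ‖ₑ + constDist f p μ) := by
  obtain ⟨K, hK⟩ := dominatedOn_enorm_integral_smul (G := G) (μ := μ) hp hB
  set s : ℝ≥0∞ := ‖∫ x, φ x ∂μ‖ₑ with hs
  set b : ℝ≥0∞ := μ univ ^ p.toReal⁻¹
  have hs0 : s ≠ 0 := by simpa [hs] using h0
  have hbt : b ≠ ⊤ := ENNReal.rpow_ne_top_of_nonneg (by positivity) (by finiteness)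
  have hsi : s⁻¹ ≠ ⊤ := ENNReal.inv_ne_top.2 hs0
  refine .of_le_mul (C := 1 + s⁻¹ * (1 + K) * b) (by finiteness) fun f (hf : Integrable f μ) => ?_
  rw [constDist, ENNReal.add_iInf, ENNReal.mul_iInf fun h => absurd h (by finiteness)]
  refine le_iInf fun c => ?_
  set J : ℝ≥0∞ := ‖∫ x, φ x • f x ∂μ‖ₑ
  set N : ℝ≥0∞ := eLpNorm (fun x => f x - c) p μ
  have hfc : AEStronglyMeasurable (fun x => f x - c) μ :=
    hf.aestronglyMeasurable.sub aestronglyMeasurable_const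
  have hc : ‖c‖ₑ ≤ s⁻¹ * (J + K * N) := by
    rw [← ENNReal.mul_le_iff_le_inv hs0 enorm_ne_top]
    exact (enorm_integral_mul_enorm_le hφ hB hf c).trans (by gcongr; exact hK _ hfc)
  have hf_eq : f = (fun x => f x - c) + fun _ => c := by funext x; simp
  calc eLpNorm f p μ ≤ N + eLpNorm (fun _ => c) p μ := by
        conv_lhs => rw [hf_eq]
        exact eLpNorm_add_le hfc aestronglyMeasurable_const hp
    _ ≤ N + ‖c‖ₑ * b := by
        gcongr
        exact eLpNorm_le_of_ae_enorm_bound (.of_forall fun _ => le_rfl)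
    _ ≤ N + s⁻¹ * (J + K * N) * b := by gcongr
    _ ≤ (J + N) + s⁻¹ * ((J + N) + K * (J + N)) * b := by gcongr <;> simp
    _ = (1 + s⁻¹ * (1 + K) * b) * (J + N) := by ring

end ConstDist

/-! ### The Poincaré inequality on a macro-element -/

section Poincare

variable {Ω V W : Set (ℝ × ℝ)} {p : ℝ≥0∞}

theorem exists_hasWeakDeriv_of_derivNorm_ne_top (hΩ : IsOpen Ω) {α : ℕ × ℕ} {v : L1 Ω}
    (h : derivNorm Ω α p v ≠ ⊤) :
    ∃ g, HasWeakDeriv Ω α v g ∧ derivNorm Ω α p v = eLpNorm g p (volume.restrict Ω) := by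
  obtain ⟨g, hg, -⟩ := derivNorm_lt_top.1 h.lt_top
  exact ⟨g, hg, derivNorm_eq hΩ hg p⟩

/-- The `L_p` norm of the weak gradient, used as the right-hand side of Poincaré's inequality. -/
noncomputable def gradNorm (Ω : Set (ℝ × ℝ)) (p : ℝ≥0∞) (f : L1 Ω) : ℝ≥0∞ :=
  derivNorm Ω (1, 0) p f + derivNorm Ω (0, 1) p f

/-- Poincaré's inequality on `V`, with the gradient measured on the larger set `Ω`; in this form
it can be glued along overlapping sets `V`. -/
def PoincareOn (Ω : Set (ℝ × ℝ)) (p : ℝ≥0∞) (V : Set (ℝ × ℝ)) : Prop :=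
  DominatedOn univ (fun f : L1 Ω => constDist f p (volume.restrict V)) (gradNorm Ω p)

theorem PoincareOn.mono_ae (h : PoincareOn Ω p V) (hW : W ≤ᵐ[volume] V) : PoincareOn Ω p W :=
  DominatedOn.trans (g := fun f : L1 Ω => constDist f p (volume.restrict V))
    (.of_le fun f _ => constDist_mono_measure f p (Measure.restrict_mono_ae hW)) h

theorem poincareOn_of_convex (hΩ : IsOpen Ω) (hVo : IsOpen V) (hV : Convex ℝ V) (hVΩ : V ⊆ Ω)
    (hne : V.Nonempty) (hb : Bornology.IsBounded V) (hp : 1 ≤ p) : PoincareOn Ω p V := by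
  have hV0 : volume V ≠ 0 := (hVo.measure_pos volume hne).ne'
  have hVt : volume V ≠ ⊤ := hb.measure_lt_top.ne
  have : IsFiniteMeasure (volume.restrict V) := ⟨by simpa using hVt.lt_top⟩
  obtain ⟨R, hR⟩ := Metric.isBounded_iff.1 hb
  have hD (x) (hx : x ∈ V) (y) (hy : y ∈ V) : ‖x - y‖ ≤ R.toNNReal :=
    (dist_eq_norm x y ▸ hR hx hy).trans (Real.le_coe_toNNReal R)
  set A : ℝ≥0∞ := (volume V)⁻¹ ^ (1 / p).toReal *
    (R.toNNReal * (2 ^ Module.finrank ℝ (ℝ × ℝ) * volume V) ^ (1 / p).toReal) with hA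
  have hAt : A ≠ ⊤ := by
    have h₁ : (volume V)⁻¹ ≠ ⊤ := ENNReal.inv_ne_top.2 hV0
    finiteness
  refine DominatedOn.of_le_mul_of_ne_top hAt fun f _ hf => ?_
  obtain ⟨g₁, h₁, e₁⟩ := exists_hasWeakDeriv_of_derivNorm_ne_top hΩ (ENNReal.add_ne_top.1 hf).1
  obtain ⟨g₂, h₂, e₂⟩ := exists_hasWeakDeriv_of_derivNorm_ne_top hΩ (ENNReal.add_ne_top.1 hf).2
  rw [gradNorm, e₁, e₂, hA, mul_assoc, mul_assoc]
  calc constDist f p (volume.restrict V)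
      ≤ (volume V)⁻¹ ^ (1 / p).toReal * oscNorm f p (volume.restrict V) := by
        simpa using constDist_le_mul_oscNorm (by simpa using hV0) hp
          ((L1.integrable_coeFn f).mono_measure (Measure.restrict_mono hVΩ le_rfl))
    _ ≤ _ := by
        gcongr
        exact oscNorm_le_of_convex hΩ.measurableSet hVo hV hVΩ hD hp h₁ h₂

theorem PoincareOn.union (hp : 1 ≤ p) (hV : PoincareOn Ω p V) (hW : PoincareOn Ω p W)
    (hVm : MeasurableSet V) (hVΩ : V ⊆ Ω) (hWΩ : W ⊆ Ω) (hΩ : volume Ω ≠ ⊤)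
    (hVW : volume (V ∩ W) ≠ 0) : PoincareOn Ω p (V ∪ W) := by
  have hWt : volume W ≠ ⊤ := measure_ne_top_of_subset hWΩ hΩ
  have hρ : (volume W / volume (V ∩ W)) ^ (1 / p.toReal) ≠ ⊤ :=
    ENNReal.rpow_ne_top_of_nonneg (by positivity) (ENNReal.div_ne_top hWt hVW)
  refine DominatedOn.trans (.of_le fun f _ => constDist_union_le hVm hWt hVW hp ?_)
    ((hV.add hW).const_mul (by finiteness))
  exact (Lp.aestronglyMeasurable f).mono_measure
    (Measure.restrict_mono (union_subset hVΩ hWΩ) le_rfl)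

theorem exists_poincareOn_of_mem (hΩ : IsOpen Ω) (hc : IsPreconnected Ω) (hv : volume Ω ≠ ⊤)
    (hp : 1 ≤ p) {x y : ℝ × ℝ} (hx : x ∈ Ω) (hy : y ∈ Ω) :
    ∃ V, IsOpen V ∧ V ⊆ Ω ∧ x ∈ V ∧ y ∈ V ∧ PoincareOn Ω p V := by
  have hball (z : ℝ × ℝ) (hz : z ∈ Ω) : ∃ r > 0, Metric.ball z r ⊆ Ω ∧
      PoincareOn Ω p (Metric.ball z r) := by
    obtain ⟨r, hr, hrΩ⟩ := Metric.isOpen_iff.1 hΩ z hz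
    exact ⟨r, hr, hrΩ, poincareOn_of_convex hΩ Metric.isOpen_ball (convex_ball z r) hrΩ
      ⟨z, Metric.mem_ball_self hr⟩ Metric.isBounded_ball hp⟩
  set U : Set (ℝ × ℝ) := {y | ∃ V, IsOpen V ∧ V ⊆ Ω ∧ x ∈ V ∧ y ∈ V ∧ PoincareOn Ω p V}
  have hUo : IsOpen U := by
    refine isOpen_iff_forall_mem_open.2 fun z hz => ?_
    obtain ⟨V, hVo, hVΩ, hxV, hzV, hV⟩ := hz
    exact ⟨V, fun w hw => ⟨V, hVo, hVΩ, hxV, hw, hV⟩, hVo, hzV⟩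
  refine hc.subset_of_closure_inter_subset hUo ?_ ?_ hy
  · obtain ⟨r, hr, hrΩ, h⟩ := hball x hx
    exact ⟨x, hx, _, Metric.isOpen_ball, hrΩ, Metric.mem_ball_self hr, Metric.mem_ball_self hr, h⟩
  · rintro z ⟨hzU, hzΩ⟩
    obtain ⟨r, hr, hrΩ, h⟩ := hball z hzΩ
    obtain ⟨w, hwb, V, hVo, hVΩ, hxV, hwV, hV⟩ :=
      mem_closure_iff.1 hzU _ Metric.isOpen_ball (Metric.mem_ball_self hr)
    refine ⟨V ∪ Metric.ball z r, hVo.union Metric.isOpen_ball, union_subset hVΩ hrΩ, .inl hxV,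
      .inr (Metric.mem_ball_self hr), hV.union hp h hVo.measurableSet hVΩ hrΩ hv ?_⟩
    exact ((hVo.inter Metric.isOpen_ball).measure_pos volume ⟨w, hwV, hwb⟩).ne'

theorem poincareOn_of_isConnected (hΩ : IsOpen Ω) (hc : IsConnected Ω) (hv : volume Ω ≠ ⊤)
    (hp : 1 ≤ p) {ι : Type*} [Finite ι] (T : ι → Set (ℝ × ℝ)) (hTo : ∀ i, IsOpen (T i))
    (hTc : ∀ i, Convex ℝ (T i)) (hTn : ∀ i, (T i).Nonempty)
    (hTb : ∀ i, Bornology.IsBounded (T i)) (hTΩ : ∀ i, T i ⊆ Ω)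
    (hcover : Ω ≤ᵐ[volume] (⋃ i, T i : Set (ℝ × ℝ))) : PoincareOn Ω p Ω := by
  obtain ⟨x, hx⟩ := hc.nonempty
  have hreach (i : ι) : ∃ V, IsOpen V ∧ V ⊆ Ω ∧ x ∈ V ∧ T i ⊆ V ∧ PoincareOn Ω p V := by
    obtain ⟨y, hy⟩ := hTn i
    obtain ⟨V, hVo, hVΩ, hxV, hyV, hV⟩ :=
      exists_poincareOn_of_mem hΩ hc.isPreconnected hv hp hx (hTΩ i hy)
    refine ⟨V ∪ T i, hVo.union (hTo i), union_subset hVΩ (hTΩ i), .inl hxV, subset_union_right,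
      hV.union hp (poincareOn_of_convex hΩ (hTo i) (hTc i) (hTΩ i) (hTn i) (hTb i) hp)
        hVo.measurableSet hVΩ (hTΩ i) hv ?_⟩
    exact ((hVo.inter (hTo i)).measure_pos volume ⟨y, hyV, hy⟩).ne'
  have hfin (s : Set ι) (hs : s.Finite) :
      ∃ V, IsOpen V ∧ V ⊆ Ω ∧ x ∈ V ∧ (∀ i ∈ s, T i ⊆ V) ∧ PoincareOn Ω p V := by
    induction s, hs using Set.Finite.induction_on with
    | empty =>
      obtain ⟨V, hVo, hVΩ, hxV, -, hV⟩ :=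
        exists_poincareOn_of_mem hΩ hc.isPreconnected hv hp hx hx
      exact ⟨V, hVo, hVΩ, hxV, by simp, hV⟩
    | @insert i s _ _ ih =>
      obtain ⟨V, hVo, hVΩ, hxV, hTV, hV⟩ := ih
      obtain ⟨W, hWo, hWΩ, hxW, hTW, hW⟩ := hreach i
      refine ⟨V ∪ W, hVo.union hWo, union_subset hVΩ hWΩ, .inl hxV,
        forall_mem_insert.2 ⟨hTW.trans subset_union_right,
          fun k hk => (hTV k hk).trans subset_union_left⟩,
        hV.union hp hW hVo.measurableSet hVΩ hWΩ hv
          ((hVo.inter hWo).measure_pos volume ⟨x, hxV, hxW⟩).ne'⟩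
  obtain ⟨V, -, -, -, hTV, hV⟩ := hfin univ finite_univ
  exact hV.mono_ae (hcover.trans (iUnion_subset fun i => hTV i (mem_univ i)).eventuallyLE)

end Poincare

namespace MacroElement

theorem isOpen_Ω (M : MacroElement) : IsOpen M.Ω := isOpen_interior

theorem volume_Ω_ne_top (M : MacroElement) : volume M.Ω ≠ ⊤ :=
  measure_ne_top_of_subset interior_subset M.isCompact_dom.measure_lt_top.ne

theorem volume_Ω_ne_zero (M : MacroElement) : volume M.Ω ≠ 0 :=
  (M.isOpen_Ω.measure_pos volume M.isConnected_interior.nonempty).ne'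

theorem poincareOn (M : MacroElement) {p : ℝ≥0∞} (hp : 1 ≤ p) : PoincareOn M.Ω p M.Ω := by
  refine poincareOn_of_isConnected M.isOpen_Ω M.isConnected_interior M.volume_Ω_ne_top hp
    (fun i => interior (M.elem i)) (fun i => isOpen_interior)
    (fun i => (M.convex_elem i).interior) M.interior_elem
    (fun i => (M.isCompact_elem i).isBounded.subset interior_subset)
    (fun i => interior_mono (subset_iUnion _ i)) ?_
  rw [ae_le_set]
  refine measure_mono_null (t := ⋃ i, frontier (M.elem i)) ?_
    (measure_iUnion_null fun i => (M.convex_elem i).addHaar_frontier volume)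
  rintro z ⟨hz, hz'⟩
  obtain ⟨i, hi⟩ := mem_iUnion.1 (interior_subset hz : z ∈ M.dom)
  exact mem_iUnion.2 ⟨i, subset_closure hi, fun h => hz' (mem_iUnion.2 ⟨i, h⟩)⟩

end MacroElement

/-! ### Sobolev norms -/

section SobolevNorm

variable {Ω : Set (ℝ × ℝ)} {P Q : Finset (ℕ × ℕ)} {α γ : ℕ × ℕ} {p : ℝ≥0∞}

theorem derivNorm_zero (Ω : Set (ℝ × ℝ)) (α : ℕ × ℕ) (p : ℝ≥0∞) : derivNorm Ω α p 0 = 0 := by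
  refine nonpos_iff_eq_zero.1 ((iInf₂_le 0 (HasWeakDeriv.zero Ω α)).trans_eq ?_)
  rw [eLpNorm_congr_ae (Lp.coeFn_zero ℝ 1 _), eLpNorm_zero]

theorem derivNorm_add_le (hp : 1 ≤ p) (v w : L1 Ω) :
    derivNorm Ω α p (v + w) ≤ derivNorm Ω α p v + derivNorm Ω α p w := by
  refine ENNReal.le_iInf₂_add_iInf₂ fun g hg k hk => (iInf₂_le _ (hg.add hk)).trans ?_
  rw [eLpNorm_congr_ae (Lp.coeFn_add g k)]
  exact eLpNorm_add_le (Lp.aestronglyMeasurable g) (Lp.aestronglyMeasurable k) hp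

theorem derivNorm_smul_le (c : ℝ) (v : L1 Ω) :
    derivNorm Ω α p (c • v) ≤ ‖c‖ₑ * derivNorm Ω α p v := by
  rcases eq_or_ne c 0 with rfl | hc
  · simp [derivNorm_zero]
  · simp only [derivNorm, ENNReal.mul_iInf_of_ne (enorm_ne_zero.2 hc) enorm_ne_top]
    refine le_iInf₂ fun g hg => (iInf₂_le _ (hg.smul c)).trans_eq ?_
    rw [eLpNorm_congr_ae (Lp.coeFn_smul c g), eLpNorm_const_smul]

theorem derivNorm_sub_le (hp : 1 ≤ p) (v w : L1 Ω) :
    derivNorm Ω α p (v - w) ≤ derivNorm Ω α p v + derivNorm Ω α p w := by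
  have hw := derivNorm_smul_le (α := α) (p := p) (-1) w
  rw [neg_one_smul, enorm_neg, enorm_one, one_mul] at hw
  rw [sub_eq_add_neg]
  exact (derivNorm_add_le hp v (-w)).trans (by gcongr)

theorem derivNorm_sum_le {ι : Type*} (hp : 1 ≤ p) (s : Finset ι) (v : ι → L1 Ω) :
    derivNorm Ω α p (∑ i ∈ s, v i) ≤ ∑ i ∈ s, derivNorm Ω α p (v i) :=
  s.le_sum_of_subadditive _ (derivNorm_zero Ω α p).le (derivNorm_add_le hp) v

theorem derivNorm_le_sobNorm (hp : 1 ≤ p) (hα : α ∈ P) (v : L1 Ω) :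
    derivNorm Ω α p v ≤ sobNorm Ω P p v := by
  unfold sobNorm
  split_ifs with h
  · exact Finset.le_sup (f := fun α => derivNorm Ω α p v) hα
  · have h0 : 0 < p.toReal := ENNReal.toReal_pos (zero_lt_one.trans_le hp).ne' h
    calc derivNorm Ω α p v = (derivNorm Ω α p v ^ p.toReal) ^ (1 / p.toReal) := by
          rw [← ENNReal.rpow_mul, mul_one_div_cancel h0.ne', ENNReal.rpow_one]
      _ ≤ _ := by
          gcongr
          exact Finset.single_le_sum (f := fun α => derivNorm Ω α p v ^ p.toReal)
            (fun _ _ => zero_le) hα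

theorem sobNorm_le_sum (P : Finset (ℕ × ℕ)) (hp : 1 ≤ p) (v : L1 Ω) :
    sobNorm Ω P p v ≤ ∑ α ∈ P, derivNorm Ω α p v := by
  unfold sobNorm
  split_ifs with h
  · exact Finset.sup_le fun α hα =>
      Finset.single_le_sum (f := fun α => derivNorm Ω α p v) (fun _ _ => zero_le) hα
  · have h1 : 1 ≤ p.toReal := by simpa using ENNReal.toReal_mono h hp
    have hsum : ∑ α ∈ P, derivNorm Ω α p v ^ p.toReal ≤
        (∑ α ∈ P, derivNorm Ω α p v) ^ p.toReal := by
      classical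
      induction P using Finset.induction_on with
      | empty => simp
      | insert a s ha ih =>
        rw [Finset.sum_insert ha, Finset.sum_insert ha]
        exact (add_le_add le_rfl ih).trans (ENNReal.add_rpow_le_rpow_add _ _ h1)
    calc _ ≤ ((∑ α ∈ P, derivNorm Ω α p v) ^ p.toReal) ^ (1 / p.toReal) := by gcongr
      _ = _ := by rw [← ENNReal.rpow_mul, mul_one_div_cancel (by linarith), ENNReal.rpow_one]

theorem dominatedOn_sobNorm {ι : Type*} {s : Set ι} {v : ι → L1 Ω} {g : ι → ℝ≥0∞} (hp : 1 ≤ p)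
    (h : ∀ α ∈ P, DominatedOn s (fun i => derivNorm Ω α p (v i)) g) :
    DominatedOn s (fun i => sobNorm Ω P p (v i)) g :=
  .trans (.of_le fun i _ => sobNorm_le_sum P hp (v i)) (.sum h)

theorem exists_hasWeakDeriv_of_mem_sobolev [hp : Fact (1 ≤ p)] {v : L1 Ω}
    (hv : v ∈ sobolev Ω (shift γ P) p) (hα : α ∈ P) : ∃ g, HasWeakDeriv Ω (α + γ) v g := by
  obtain ⟨g, hg, -⟩ := derivNorm_lt_top.1
    ((sobNorm_lt_top hp.out).1 hv (α + γ) (Finset.mem_image_of_mem _ hα))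
  exact ⟨g, hg⟩

theorem subset_hull (Q : Finset (ℕ × ℕ)) : Q ⊆ hull Q := fun _ h => by simp [hull, h]

theorem add_fst_mem_hull (h : α ∈ Q) : α + (1, 0) ∈ hull Q :=
  Finset.mem_union_left _ (Finset.mem_union_right _ (Finset.mem_image_of_mem _ h))

theorem add_snd_mem_hull (h : α ∈ Q) : α + (0, 1) ∈ hull Q :=
  Finset.mem_union_right _ (Finset.mem_image_of_mem _ h)

theorem hull_shift (γ : ℕ × ℕ) (Q : Finset (ℕ × ℕ)) : hull (shift γ Q) = shift γ (hull Q) := by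
  simp only [hull, shift, Finset.image_union, Finset.image_image, Function.comp_def,
    add_right_comm _ γ]

theorem sobSemi_shift (γ : ℕ × ℕ) (Q : Finset (ℕ × ℕ)) (p : ℝ≥0∞) (v : L1 Ω) :
    sobSemi Ω (shift γ Q) p v = sobNorm Ω (shift γ (hull Q \ Q)) p v := by
  rw [sobSemi, hull_shift, shift, shift, shift, Finset.image_sdiff _ _ (add_left_injective γ)]

theorem derivNorm_le_sobSemi_shift (hp : 1 ≤ p) (hα : α ∈ hull Q \ Q) (v : L1 Ω) :
    derivNorm Ω (α + γ) p v ≤ sobSemi Ω (shift γ Q) p v := by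
  rw [sobSemi_shift]
  exact derivNorm_le_sobNorm hp (Finset.mem_image_of_mem _ hα) v

end SobolevNorm

/-! ### Bounds by the semi-norm -/

section SemiNorm

variable {Ω : Set (ℝ × ℝ)} {p : ℝ≥0∞} {Q : Finset (ℕ × ℕ)}

theorem PoincareOn.dominatedOn_derivNorm (h : PoincareOn Ω p Ω) (hΩ : IsOpen Ω)
    (hv : volume Ω ≠ ⊤) (hp : 1 ≤ p) {φ : ℝ × ℝ → ℝ} (hφ : AEStronglyMeasurable φ) {B : ℝ≥0}
    (hB : ∀ x, ‖φ x‖ ≤ B) (h0 : ∫ x in Ω, φ x ≠ 0) (α : ℕ × ℕ) :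
    DominatedOn {w : L1 Ω × L1 Ω | HasWeakDeriv Ω α w.1 w.2} (fun w => derivNorm Ω α p w.1)
      (fun w => ‖∫ x in Ω, φ x • w.2 x‖ₑ +
        (derivNorm Ω (α + (1, 0)) p w.1 + derivNorm Ω (α + (0, 1)) p w.1)) := by
  have : IsFiniteMeasure (volume.restrict Ω) := ⟨by simpa using hv.lt_top⟩
  obtain ⟨C, hC⟩ := dominatedOn_eLpNorm_of_integral_ne_zero (G := ℝ) hp hφ.restrict hB h0
  obtain ⟨D, hD⟩ := h
  refine .of_le_mul (C := C * (1 + D)) (by finiteness) ?_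
  rintro ⟨v, g⟩ (hg : HasWeakDeriv Ω α v g)
  rw [derivNorm_eq hΩ hg, add_comm α, add_comm α, hg.derivNorm_add_eq, hg.derivNorm_add_eq]
  calc eLpNorm g p (volume.restrict Ω)
      ≤ C * (‖∫ x in Ω, φ x • g x‖ₑ + constDist g p (volume.restrict Ω)) :=
        hC _ (L1.integrable_coeFn g)
    _ ≤ C * (‖∫ x in Ω, φ x • g x‖ₑ + D * gradNorm Ω p g) := by
        gcongr
        exact hD g (mem_univ g)
    _ ≤ C * ((1 + D) * ‖∫ x in Ω, φ x • g x‖ₑ + (1 + D) * gradNorm Ω p g) := by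
        gcongr
        · exact le_mul_of_one_le_left' le_self_add
        · exact le_add_self
    _ = C * (1 + D) * (‖∫ x in Ω, φ x • g x‖ₑ + gradNorm Ω p g) := by ring

theorem dominatedOn_of_succ {ι : Type*} {s : Set ι} {N : ℕ × ℕ → ι → ℝ≥0∞} {B : ι → ℝ≥0∞}
    {E : Set (ℕ × ℕ)} (hE : E.Finite)
    (h : ∀ β ∈ E, DominatedOn s (N β) B ∨ β + (1, 0) ∈ E ∧ β + (0, 1) ∈ E ∧
      DominatedOn s (N β) (fun i => B i + (N (β + (1, 0)) i + N (β + (0, 1)) i)))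
    {β : ℕ × ℕ} (hβ : β ∈ E) : DominatedOn s (N β) B := by
  refine Set.WellFoundedOn.induction (hE.wellFoundedOn (r := (· > ·))) hβ
    (P := fun β => DominatedOn s (N β) B) fun β hβ ih => ?_
  rcases h β hβ with hB | ⟨h₁, h₂, hN⟩
  · exact hB
  · exact hN.trans (.add (.of_le fun _ _ => le_rfl)
      (.add (ih _ h₁ (by simp [Prod.lt_iff])) (ih _ h₂ (by simp [Prod.lt_iff]))))

theorem PoincareOn.dominatedOn_derivNorm_of_integral_eq_zero (h : PoincareOn Ω p Ω)
    (hΩ : IsOpen Ω) (hv : volume Ω ≠ ⊤) (hv0 : volume Ω ≠ 0) (hp : 1 ≤ p) (γ : ℕ × ℕ)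
    {β : ℕ × ℕ} (hβ : β ∈ hull Q) :
    DominatedOn {v | ∀ α ∈ Q, ∃ g, HasWeakDeriv Ω (α + γ) v g ∧ ∫ x in Ω, g x = 0}
      (derivNorm Ω (β + γ) p) (sobSemi Ω (shift γ Q) p) := by
  have hone : ∫ _ in Ω, (1 : ℝ) ≠ 0 := by
    simp [Measure.real, ENNReal.toReal_eq_zero_iff, hv, hv0]
  refine dominatedOn_of_succ (N := fun β => derivNorm Ω (β + γ) p) (hull Q).finite_toSet
    (fun α hα => ?_) hβ
  by_cases hαQ : α ∈ Q
  · refine .inr ⟨add_fst_mem_hull hαQ, add_snd_mem_hull hαQ, ?_⟩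
    obtain ⟨C, hC⟩ := h.dominatedOn_derivNorm hΩ hv hp (φ := fun _ => 1) (B := 1)
      aestronglyMeasurable_const (by simp) hone (α + γ)
    refine ⟨C, fun v hv => ?_⟩
    obtain ⟨g, hg, hg0⟩ := hv α hαQ
    have hvg := hC (v, g) hg
    simp only [one_smul, hg0, enorm_zero, zero_add, add_right_comm α γ] at hvg
    exact hvg.trans (by gcongr; exact le_add_self)
  · exact .inl (.of_le fun v _ => derivNorm_le_sobSemi_shift hp (Finset.mem_sdiff.2 ⟨hα, hαQ⟩) v)

theorem exists_contDiff_integral_ne_zero (hΩ : IsOpen Ω) (hne : Ω.Nonempty) :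
    ∃ φ : ℝ × ℝ → ℝ, ContDiff ℝ ∞ φ ∧ HasCompactSupport φ ∧ tsupport φ ⊆ Ω ∧
      ∫ x in Ω, φ x ≠ 0 := by
  obtain ⟨x, hx⟩ := hne
  obtain ⟨φ, hφΩ, hc, hφ, hφr, hφx⟩ := exists_contDiff_tsupport_subset (n := ⊤) (hΩ.mem_nhds hx)
  refine ⟨φ, hφ, hc, hφΩ, ne_of_gt ?_⟩
  rw [setIntegral_eq_integral_of_forall_compl_eq_zero fun y hy =>
    image_eq_zero_of_notMem_tsupport fun hy' => hy (hφΩ hy')]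
  exact hφ.continuous.integral_pos_of_hasCompactSupport_nonneg_nonzero hc
    (fun y => (hφr (mem_range_self y)).1) (x := x) (by simp [hφx])

theorem dominatedOn_enorm_integral_of_hasWeakDeriv (hv : volume Ω ≠ ⊤) (hp : 1 ≤ p)
    {φ : ℝ × ℝ → ℝ} (hφ : ContDiff ℝ ∞ φ) (hc : HasCompactSupport φ) (hs : tsupport φ ⊆ Ω)
    (δ : ℕ × ℕ) :
    DominatedOn {w : L1 Ω × L1 Ω | HasWeakDeriv Ω δ w.1 w.2} (fun w => ‖∫ x in Ω, φ x • w.2 x‖ₑ)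
      (fun w => eLpNorm w.1 p (volume.restrict Ω)) := by
  have : IsFiniteMeasure (volume.restrict Ω) := ⟨by simpa using hv.lt_top⟩
  obtain ⟨hD, hDc⟩ := classicalDeriv_aux δ hφ hc
  obtain ⟨B, hB⟩ := hD.continuous.bounded_above_of_compact_support hDc
  obtain ⟨K, hK⟩ := dominatedOn_enorm_integral_smul (G := ℝ) (μ := volume.restrict Ω) hp
    (B := B.toNNReal) fun x => (hB x).trans (Real.le_coe_toNNReal B)
  refine ⟨K, fun w hw => le_trans (le_of_eq ?_) (hK _ (Lp.aestronglyMeasurable w.1))⟩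
  simp only [smul_eq_mul, mul_comm _ (w.1 _), mul_comm _ (w.2 _), hw φ hφ hc hs, enorm_mul,
    enorm_pow, enorm_neg, enorm_one, one_pow, one_mul]

theorem PoincareOn.dominatedOn_derivNorm_add_eLpNorm (h : PoincareOn Ω p Ω) (hΩ : IsOpen Ω)
    (hne : Ω.Nonempty) (hv : volume Ω ≠ ⊤) (hp : 1 ≤ p) (δ : ℕ × ℕ) :
    DominatedOn {w : L1 Ω × L1 Ω | HasWeakDeriv Ω δ w.1 w.2} (fun w => derivNorm Ω δ p w.1)
      (fun w => eLpNorm w.1 p (volume.restrict Ω) +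
        (derivNorm Ω (δ + (1, 0)) p w.1 + derivNorm Ω (δ + (0, 1)) p w.1)) := by
  obtain ⟨φ, hφ, hc, hs, h0⟩ := exists_contDiff_integral_ne_zero hΩ hne
  obtain ⟨B, hB⟩ := hφ.continuous.bounded_above_of_compact_support hc
  refine (h.dominatedOn_derivNorm hΩ hv hp hφ.continuous.aestronglyMeasurable (B := B.toNNReal)
    (fun x => (hB x).trans (Real.le_coe_toNNReal B)) h0 δ).trans
      (.add (.trans ?_ (.of_le fun _ _ => le_self_add)) (.of_le fun _ _ => le_add_self))
  exact dominatedOn_enorm_integral_of_hasWeakDeriv hv hp hφ hc hs δ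

theorem PoincareOn.dominatedOn_derivNorm_of_le (h : PoincareOn Ω p Ω) (hΩ : IsOpen Ω)
    (hne : Ω.Nonempty) (hv : volume Ω ≠ ⊤) (hp : 1 ≤ p) (γ : ℕ × ℕ) {α β : ℕ × ℕ}
    (hα : α ∈ hull Q \ Q) (hβ : β ∈ hull Q) (hαβ : α ≤ β) :
    DominatedOn {v | ∀ β ∈ hull Q, ∃ g, HasWeakDeriv Ω (β + γ) v g}
      (derivNorm Ω (β + γ) p) (sobSemi Ω (shift γ Q) p) := by
  refine dominatedOn_of_succ (N := fun β => derivNorm Ω (β + γ) p) (E := {β ∈ hull Q | α ≤ β})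
    ((hull Q).finite_toSet.subset fun _ hβ => hβ.1) ?_ ⟨hβ, hαβ⟩
  rintro β ⟨hβ, hαβ⟩
  by_cases hβQ : β ∈ Q
  · refine .inr ⟨⟨add_fst_mem_hull hβQ, hαβ.trans le_self_add⟩,
      ⟨add_snd_mem_hull hβQ, hαβ.trans le_self_add⟩, ?_⟩
    obtain ⟨δ, rfl⟩ := exists_add_of_le hαβ
    obtain ⟨C, hC⟩ := h.dominatedOn_derivNorm_add_eLpNorm hΩ hne hv hp δ
    refine ⟨C, fun v hv => ?_⟩
    obtain ⟨f, hf⟩ := hv α (Finset.mem_sdiff.1 hα).1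
    obtain ⟨g, hg⟩ := hv (α + δ) hβ
    have hδ (e : ℕ × ℕ) : α + δ + e + γ = δ + e + (α + γ) := by abel
    have hδ0 : α + δ + γ = δ + (α + γ) := hδ 0
    have hfg : HasWeakDeriv Ω δ f g := hf.hasWeakDeriv_add_iff.1 (hδ0 ▸ hg)
    simp only [hδ, hδ0, hf.derivNorm_add_eq]
    have hfN : eLpNorm f p (volume.restrict Ω) ≤ sobSemi Ω (shift γ Q) p v :=
      (derivNorm_eq hΩ hf p).symm.trans_le (derivNorm_le_sobSemi_shift hp hα v)
    exact (hC (f, g) hfg).trans (mul_le_mul_right (add_le_add_left hfN _) _)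
  · exact .inl (.of_le fun v _ => derivNorm_le_sobSemi_shift hp (Finset.mem_sdiff.2 ⟨hβ, hβQ⟩) v)

end SemiNorm

/-! ### Triangular systems -/

section Triangular

variable {ι : Type*} [PartialOrder ι] {Q : Finset ι} {A : ι → ι → ℝ}

theorem dominatedOn_of_triangular {κ : Type*} {s : Set κ} {c : κ → ι → ℝ} {g : κ → ℝ≥0∞}
    (hA : ∀ α β, ¬ α ≤ β → A α β = 0) (hd : ∀ α, A α α ≠ 0) {α : ι}
    (h : ∀ β ∈ Q, α ≤ β → DominatedOn s (fun k => ‖∑ β' ∈ Q, A β β' * c k β'‖ₑ) g)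
    {β : ι} (hβ : β ∈ Q) (hαβ : α ≤ β) : DominatedOn s (fun k => ‖c k β‖ₑ) g := by
  classical
  revert hαβ
  refine Set.WellFoundedOn.induction (Q.finite_toSet.wellFoundedOn (r := (· > ·))) hβ
    (P := fun β => α ≤ β → DominatedOn s (fun k => ‖c k β‖ₑ) g) fun β hβ ih hαβ => ?_
  have hrest : ∀ β' ∈ Q.erase β, DominatedOn s (fun k => ‖A β β' * c k β'‖ₑ) g := by
    intro β' hβ'
    obtain ⟨hne, hβ'Q⟩ := Finset.mem_erase.1 hβ'
    by_cases hle : β ≤ β'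
    · simp only [enorm_mul]
      exact (ih β' hβ'Q (hle.lt_of_ne' hne) (hαβ.trans hle)).const_mul enorm_ne_top
    · exact .of_le fun k _ => by simp [hA β β' hle]
  have hsolve (k : κ) : c k β =
      (A β β)⁻¹ * (∑ β' ∈ Q, A β β' * c k β' - ∑ β' ∈ Q.erase β, A β β' * c k β') := by
    rw [← Finset.add_sum_erase Q _ hβ, add_sub_cancel_right, inv_mul_cancel_left₀ (hd β)]
  refine .trans (.of_le fun k _ => ?_)
    (((h β hβ hαβ).add (.sum hrest)).const_mul (K := ‖(A β β)⁻¹‖ₑ) enorm_ne_top)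
  conv_lhs => rw [hsolve k, enorm_mul]
  gcongr
  exact enorm_sub_le.trans (add_le_add_right (enorm_sum_le _ _) _)

theorem eq_zero_of_triangular (hA : ∀ α β, ¬ α ≤ β → A α β = 0) (hd : ∀ α, A α α ≠ 0)
    {c : ι → ℝ} (h : ∀ α ∈ Q, ∑ β ∈ Q, A α β * c β = 0) {α : ι} (hα : α ∈ Q) : c α = 0 := by
  obtain ⟨C, hC⟩ := dominatedOn_of_triangular (s := univ) (c := fun _ : Unit => c) (g := 0) hA hd
    (fun β hβ _ => .of_le fun _ _ => by simp [h β hβ]) hα le_rfl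
  simpa using hC () (mem_univ _)

theorem exists_sum_mul_eq_of_triangular (hA : ∀ α β, ¬ α ≤ β → A α β = 0)
    (hd : ∀ α, A α α ≠ 0) (b : ι → ℝ) : ∃ c : ι → ℝ, ∀ α ∈ Q, ∑ β ∈ Q, A α β * c β = b α := by
  classical
  set T : (Q → ℝ) →ₗ[ℝ] (Q → ℝ) := Matrix.toLin' (Matrix.of fun α β : Q => A α β)
  have hT (c : Q → ℝ) (α : Q) : T c α = ∑ β : Q, A α β * c β := rfl
  have hinj : Function.Injective T := by
    rw [← LinearMap.ker_eq_bot, LinearMap.ker_eq_bot']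
    refine fun c hc => funext fun α => eq_zero_of_triangular (Q := Finset.univ)
      (A := fun α β : Q => A α β) (fun α β => hA α β) (fun α => hd α) (fun β _ => ?_)
      (Finset.mem_univ α)
    rw [← hT, hc, Pi.zero_apply]
  obtain ⟨c, hc⟩ := LinearMap.injective_iff_surjective.1 hinj fun α => b α
  refine ⟨Function.extend Subtype.val c 0, fun α hα => ?_⟩
  rw [← Finset.sum_coe_sort Q, ← congr_fun hc ⟨α, hα⟩, hT]
  exact Finset.sum_congr rfl fun β _ => by rw [Subtype.val_injective.extend_apply]

end Triangular

/-! ### The mean value polynomial -/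

/-- The coefficient `β! / (β - α)!` of `X^(β - α)` in `D^α X^β`. The descending factorials make it
vanish unless `α ≤ β`, so that the truncated difference `β - α` is harmless. -/
noncomputable def derivCoeff (α β : ℕ × ℕ) : ℝ :=
  (β.1.descFactorial α.1 : ℝ) * (β.2.descFactorial α.2 : ℝ)

theorem derivCoeff_eq_zero {α β : ℕ × ℕ} (h : ¬ α ≤ β) : derivCoeff α β = 0 := by
  rw [Prod.le_def, not_and_or, not_le, not_le] at h
  rcases h with h | h <;> simp [derivCoeff, Nat.descFactorial_of_lt h]

theorem derivCoeff_self_ne_zero (α : ℕ × ℕ) : derivCoeff α α ≠ 0 := by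
  simp [derivCoeff, Nat.descFactorial_self, Nat.factorial_ne_zero]

theorem integral_coeFn_sum_smul {Ω : Set (ℝ × ℝ)} {ι : Type*} (s : Finset ι) (c : ι → ℝ)
    (v : ι → L1 Ω) :
    ∫ z in Ω, (∑ i ∈ s, c i • v i : L1 Ω) z = ∑ i ∈ s, c i * ∫ z in Ω, v i z := by
  have hI (v : L1 Ω) : ∫ z in Ω, v z = L1.integralCLM (E := ℝ) (μ := volume.restrict Ω) v :=
    (L1.integral_eq_integral v).symm.trans (L1.integral_eq v)
  simp only [hI, map_sum, map_smul, smul_eq_mul]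

theorem integral_coeFn_sub {Ω : Set (ℝ × ℝ)} (v w : L1 Ω) :
    ∫ z in Ω, (v - w : L1 Ω) z = (∫ z in Ω, v z) - ∫ z in Ω, w z := by
  rw [integral_congr_ae (Lp.coeFn_sub v w)]
  exact integral_sub (L1.integrable_coeFn v) (L1.integrable_coeFn w)

namespace MacroElement

variable (M : MacroElement) (μ : ℕ) {p : ℝ≥0∞} {Q : Finset (ℕ × ℕ)} {γ : ℕ × ℕ}

theorem coeFn_toL1 (u : M.CSpace μ) : M.toL1 μ u =ᵐ[volume.restrict M.Ω] M.zeroExt u.1 :=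
  (M.integrable_zeroExt u).coeFn_toL1

theorem eLpNorm_toL1_lt_top (u : M.CSpace μ) (p : ℝ≥0∞) :
    eLpNorm (M.toL1 μ u) p (volume.restrict M.Ω) < ⊤ := by
  have : IsFiniteMeasure (volume.restrict M.Ω) := ⟨by simpa using M.volume_Ω_ne_top.lt_top⟩
  obtain ⟨g, hg, hu⟩ := u.2
  obtain ⟨B, hB⟩ := M.isCompact_dom.exists_bound_of_continuousOn hg.continuousOn
  refine (MemLp.of_bound (Lp.aestronglyMeasurable _) B ?_).2
  filter_upwards [M.coeFn_toL1 μ u, ae_restrict_mem M.isOpen_Ω.measurableSet] with z hz hzΩ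
  have hzd : z ∈ M.dom := interior_subset hzΩ
  simpa [hz, zeroExt, hzd, hu] using hB z hzd

theorem coeFn_toL1_monomial (β : ℕ × ℕ) :
    M.toL1 μ (M.monomial μ β) =ᵐ[volume.restrict M.Ω] fun z => z.1 ^ β.1 * z.2 ^ β.2 := by
  filter_upwards [M.coeFn_toL1 μ (M.monomial μ β), ae_restrict_mem M.isOpen_Ω.measurableSet]
    with z hz hzΩ
  have hzd : z ∈ M.dom := interior_subset hzΩ
  rw [hz]
  simp [zeroExt, hzd, monomial]

theorem hasWeakDeriv_monomial (α β : ℕ × ℕ) :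
    HasWeakDeriv M.Ω α (M.toL1 μ (M.monomial μ β))
      (derivCoeff α β • M.toL1 μ (M.monomial μ (β - α))) := by
  refine .of_contDiff (f := fun z => z.1 ^ β.1 * z.2 ^ β.2) (by fun_prop)
    (M.coeFn_toL1_monomial μ β) ?_
  rw [classicalDeriv_monomial]
  filter_upwards [Lp.coeFn_smul (derivCoeff α β) (M.toL1 μ (M.monomial μ (β - α))),
    M.coeFn_toL1_monomial μ (β - α)] with z hsmul hmon
  rw [hsmul, Pi.smul_apply, hmon]
  rfl

theorem derivNorm_monomial (α β : ℕ × ℕ) (p : ℝ≥0∞) :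
    derivNorm M.Ω α p (M.toL1 μ (M.monomial μ β)) = ‖derivCoeff α β‖ₑ *
      eLpNorm (M.toL1 μ (M.monomial μ (β - α))) p (volume.restrict M.Ω) := by
  rw [derivNorm_eq M.isOpen_Ω (M.hasWeakDeriv_monomial μ α β), eLpNorm_congr_ae (Lp.coeFn_smul _ _),
    eLpNorm_const_smul]

/-- The polynomial `∑_{β ∈ Q} c_β X^(β+γ)`, the general element of `(Q + γ)(Λ)`. -/
noncomputable def poly (Q : Finset (ℕ × ℕ)) (γ : ℕ × ℕ) (c : ℕ × ℕ → ℝ) : M.CSpace μ :=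
  ∑ β ∈ Q, c β • M.monomial μ (β + γ)

theorem mem_polySpace_shift {q : M.CSpace μ} :
    q ∈ M.polySpace μ (shift γ Q) ↔ ∃ c : ℕ × ℕ → ℝ, q = M.poly μ Q γ c := by
  have himg : M.monomial μ '' (shift γ Q : Finset (ℕ × ℕ)) =
      (fun β => M.monomial μ (β + γ)) '' (Q : Set (ℕ × ℕ)) := by
    rw [shift, Finset.coe_image, image_image]
  rw [polySpace, himg, Submodule.mem_span_image_finset_iff_exists_fun]
  constructor
  · rintro ⟨c, rfl⟩
    refine ⟨Function.extend Subtype.val c 0, ?_⟩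
    rw [poly, ← Finset.sum_coe_sort Q]
    exact Finset.sum_congr rfl fun β _ => by rw [Subtype.val_injective.extend_apply]
  · rintro ⟨c, rfl⟩
    exact ⟨fun β => c β, Finset.sum_coe_sort Q fun β => c β • M.monomial μ (β + γ)⟩

/-- The integral of `D^(α+γ) X^(β+γ)` over the reference domain, the entry of the linear system
for the coefficients of the mean value polynomial. -/
noncomputable def meanMatrix (γ α β : ℕ × ℕ) : ℝ :=
  derivCoeff (α + γ) (β + γ) * ∫ z in M.Ω, z.1 ^ (β - α).1 * z.2 ^ (β - α).2

theorem meanMatrix_eq_zero (γ α β : ℕ × ℕ) (h : ¬ α ≤ β) : M.meanMatrix γ α β = 0 := by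
  rw [meanMatrix, derivCoeff_eq_zero (by simpa using h), zero_mul]

theorem meanMatrix_self_ne_zero (γ α : ℕ × ℕ) : M.meanMatrix γ α α ≠ 0 := by
  refine mul_ne_zero (derivCoeff_self_ne_zero _) ?_
  simp [Measure.real, ENNReal.toReal_eq_zero_iff, M.volume_Ω_ne_zero, M.volume_Ω_ne_top]

theorem exists_hasWeakDeriv_poly (Q : Finset (ℕ × ℕ)) (γ : ℕ × ℕ) (c : ℕ × ℕ → ℝ) (α : ℕ × ℕ) :
    ∃ g, HasWeakDeriv M.Ω (α + γ) (M.toL1 μ (M.poly μ Q γ c)) g ∧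
      ∫ z in M.Ω, g z = ∑ β ∈ Q, M.meanMatrix γ α β * c β := by
  refine ⟨∑ β ∈ Q, (c β * derivCoeff (α + γ) (β + γ)) • M.toL1 μ (M.monomial μ (β - α)), ?_, ?_⟩
  · rw [poly, map_sum]
    refine .sum _ fun β _ => ?_
    have hβ := M.hasWeakDeriv_monomial μ (α + γ) (β + γ)
    rw [add_tsub_add_eq_tsub_right] at hβ
    rw [map_smul, mul_smul]
    exact hβ.smul _
  · rw [integral_coeFn_sum_smul]
    refine Finset.sum_congr rfl fun β _ => ?_
    rw [integral_congr_ae (M.coeFn_toL1_monomial μ (β - α)), meanMatrix]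
    ring

theorem isMeanPolynomial_poly_iff {u : M.CSpace μ} {d : ℕ × ℕ → L1 M.Ω}
    (hd : ∀ α ∈ Q, HasWeakDeriv M.Ω (α + γ) (M.toL1 μ u) (d α)) (c : ℕ × ℕ → ℝ) :
    M.IsMeanPolynomial Q γ u (M.poly μ Q γ c) ↔
      ∀ α ∈ Q, ∑ β ∈ Q, M.meanMatrix γ α β * c β = ∫ z in M.Ω, d α z := by
  choose k hk hkI using M.exists_hasWeakDeriv_poly μ Q γ c
  have hw (α : ℕ × ℕ) (hα : α ∈ Q) :
      HasWeakDeriv M.Ω (α + γ) (M.toL1 μ (u - M.poly μ Q γ c)) (d α - k α) := by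
    rw [map_sub]
    exact (hd α hα).sub (hk α)
  constructor
  · rintro ⟨-, h⟩ α hα
    obtain ⟨g, hg, hg0⟩ := h α hα
    rw [hg.unique M.isOpen_Ω (hw α hα), integral_coeFn_sub, hkI] at hg0
    exact (sub_eq_zero.1 hg0).symm
  · refine fun h => ⟨(M.mem_polySpace_shift μ).2 ⟨c, rfl⟩, fun α hα => ⟨_, hw α hα, ?_⟩⟩
    rw [integral_coeFn_sub, hkI, h α hα, sub_self]

theorem existsUnique_isMeanPolynomial {u : M.CSpace μ}
    (hu : ∀ α ∈ Q, ∃ g, HasWeakDeriv M.Ω (α + γ) (M.toL1 μ u) g) :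
    ∃! q, M.IsMeanPolynomial Q γ u q := by
  choose! d hd using hu
  have hiff := M.isMeanPolynomial_poly_iff μ hd
  obtain ⟨c, hc⟩ := exists_sum_mul_eq_of_triangular (Q := Q) (M.meanMatrix_eq_zero γ)
    (M.meanMatrix_self_ne_zero γ) fun α => ∫ z in M.Ω, d α z
  refine ⟨M.poly μ Q γ c, (hiff c).2 hc, fun q hq => ?_⟩
  obtain ⟨a, rfl⟩ := (M.mem_polySpace_shift μ).1 hq.1
  refine Finset.sum_congr rfl fun β hβ => congr_arg (· • _) (sub_eq_zero.1 ?_)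
  refine eq_zero_of_triangular (c := fun β => a β - c β) (M.meanMatrix_eq_zero γ)
    (M.meanMatrix_self_ne_zero γ) (fun α hα => ?_) hβ
  simp only [mul_sub, Finset.sum_sub_distrib, (hiff a).1 hq α hα, hc α hα, sub_self]

/-- The pairs of a function `u` with weak derivatives over `hull Q + γ` and a coefficient vector of
its mean value polynomial; the constants of the estimates do not depend on such a pair. -/
def meanPairs (Q : Finset (ℕ × ℕ)) (γ : ℕ × ℕ) : Set (M.CSpace μ × (ℕ × ℕ → ℝ)) :=
  {w | (∀ β ∈ hull Q, ∃ g, HasWeakDeriv M.Ω (β + γ) (M.toL1 μ w.1) g) ∧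
    M.IsMeanPolynomial Q γ w.1 (M.poly μ Q γ w.2)}

theorem dominatedOn_enorm_meanPolynomial_coeff (hp : 1 ≤ p) {α β : ℕ × ℕ}
    (hα : α ∈ hull Q \ Q) (hβ : β ∈ Q) (hαβ : α ≤ β) :
    DominatedOn (M.meanPairs μ Q γ) (fun w => ‖w.2 β‖ₑ)
      (fun w => sobSemi M.Ω (shift γ Q) p (M.toL1 μ w.1)) := by
  have : IsFiniteMeasure (volume.restrict M.Ω) := ⟨by simpa using M.volume_Ω_ne_top.lt_top⟩
  refine dominatedOn_of_triangular (M.meanMatrix_eq_zero γ) (M.meanMatrix_self_ne_zero γ)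
    (fun β hβ hαβ => ?_) hβ hαβ
  have hderiv : DominatedOn (M.meanPairs μ Q γ)
      (fun w => derivNorm M.Ω (β + γ) p (M.toL1 μ w.1))
      (fun w => sobSemi M.Ω (shift γ Q) p (M.toL1 μ w.1)) :=
    ((M.poincareOn hp).dominatedOn_derivNorm_of_le M.isOpen_Ω M.isConnected_interior.nonempty
      M.volume_Ω_ne_top hp γ hα (subset_hull Q hβ) hαβ).comp fun w hw => hw.1
  obtain ⟨K, hK⟩ := dominatedOn_enorm_integral_smul (G := ℝ) (μ := volume.restrict M.Ω) hp
    (φ := fun _ => 1) (B := 1) (by simp)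
  refine .trans ⟨K, fun w hw => ?_⟩ hderiv
  choose! d hd using hw.1
  have hmean := (M.isMeanPolynomial_poly_iff μ (fun α hα => hd α (subset_hull Q hα)) w.2).1 hw.2
  simp only [hmean β hβ, derivNorm_eq M.isOpen_Ω (hd β (subset_hull Q hβ))]
  simpa only [one_smul] using hK _ (Lp.aestronglyMeasurable (d β))

theorem dominatedOn_derivNorm_meanPolynomial (hp : 1 ≤ p) {α : ℕ × ℕ} (hα : α ∈ hull Q \ Q) :
    DominatedOn (M.meanPairs μ Q γ)
      (fun w => derivNorm M.Ω (α + γ) p (M.toL1 μ (M.poly μ Q γ w.2)))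
      (fun w => sobSemi M.Ω (shift γ Q) p (M.toL1 μ w.1)) := by
  set N : ℕ × ℕ → ℝ≥0∞ := fun β =>
    derivNorm M.Ω (α + γ) p (M.toL1 μ (M.monomial μ (β + γ)))
  have hterm : ∀ β ∈ Q, DominatedOn (M.meanPairs μ Q γ) (fun w => N β * ‖w.2 β‖ₑ)
      (fun w => sobSemi M.Ω (shift γ Q) p (M.toL1 μ w.1)) := by
    intro β hβ
    have hN := M.derivNorm_monomial μ (α + γ) (β + γ) p
    by_cases hαβ : α ≤ β
    · have hNt : N β ≠ ⊤ :=
        hN.trans_ne (ENNReal.mul_ne_top enorm_ne_top (M.eLpNorm_toL1_lt_top μ _ p).ne)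
      exact (M.dominatedOn_enorm_meanPolynomial_coeff μ hp hα hβ hαβ).const_mul hNt
    · have hN0 : N β = 0 := hN.trans (by rw [derivCoeff_eq_zero (by simpa using hαβ)]; simp)
      exact .of_le fun w _ => by simp [hN0]
  refine .trans (.of_le fun w _ => ?_) (.sum hterm)
  rw [poly, map_sum]
  refine (derivNorm_sum_le hp _ _).trans (Finset.sum_le_sum fun β _ => ?_)
  rw [map_smul, mul_comm]
  exact derivNorm_smul_le _ _

theorem dominatedOn_derivNorm_sub_meanPolynomial (hp : 1 ≤ p) {β : ℕ × ℕ} (hβ : β ∈ hull Q) :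
    DominatedOn {w : M.CSpace μ × M.CSpace μ |
        (∀ β ∈ hull Q, ∃ g, HasWeakDeriv M.Ω (β + γ) (M.toL1 μ w.1) g) ∧
          M.IsMeanPolynomial Q γ w.1 w.2}
      (fun w => derivNorm M.Ω (β + γ) p (M.toL1 μ (w.1 - w.2)))
      (fun w => sobSemi M.Ω (shift γ Q) p (M.toL1 μ w.1)) := by
  have hsemi : DominatedOn (M.meanPairs μ Q γ)
      (fun w => sobSemi M.Ω (shift γ Q) p (M.toL1 μ (w.1 - M.poly μ Q γ w.2)))
      (fun w => sobSemi M.Ω (shift γ Q) p (M.toL1 μ w.1)) := by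
    simp only [map_sub]
    refine .trans (.of_le fun w _ => (sobSemi_shift γ Q p _).le)
      (dominatedOn_sobNorm hp (Finset.forall_mem_image.2 fun α hα => ?_))
    exact .trans (.of_le fun w _ => derivNorm_sub_le hp _ _)
      (.add (.of_le fun w _ => derivNorm_le_sobSemi_shift hp hα _)
        (M.dominatedOn_derivNorm_meanPolynomial μ hp hα))
  have hmean : DominatedOn (M.meanPairs μ Q γ)
      (fun w => derivNorm M.Ω (β + γ) p (M.toL1 μ (w.1 - M.poly μ Q γ w.2)))
      (fun w => sobSemi M.Ω (shift γ Q) p (M.toL1 μ (w.1 - M.poly μ Q γ w.2))) :=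
    ((M.poincareOn hp).dominatedOn_derivNorm_of_integral_eq_zero M.isOpen_Ω M.volume_Ω_ne_top
      M.volume_Ω_ne_zero hp γ hβ).comp fun w hw => hw.2.2
  obtain ⟨C, hC⟩ := hmean.trans hsemi
  refine ⟨C, fun ⟨u, q⟩ ⟨hu, hq⟩ => ?_⟩
  obtain ⟨c, rfl⟩ := (M.mem_polySpace_shift μ).1 hq.1
  exact hC (u, c) ⟨hu, hq⟩

end MacroElement

/-! ### Norming functionals -/

theorem dominatedOn_sum_enorm_of_injective {A ι : Type*} [AddCommGroup A] [Module ℝ A] [Fintype ι]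
    (T : A →ₗ[ℝ] (ι → ℝ)) (hT : Function.Injective T) {N : A → ℝ≥0∞}
    (hadd : ∀ x y, N (x + y) ≤ N x + N y) (hsmul : ∀ (c : ℝ) x, N (c • x) ≤ ‖c‖ₑ * N x)
    (hN : ∀ x, N x ≠ ⊤) : DominatedOn univ N (fun x => ∑ i, ‖T x i‖ₑ) := by
  classical
  obtain ⟨g, hg⟩ := T.exists_leftInverse_of_injective (LinearMap.ker_eq_bot.2 hT)
  set a : ι → A := fun i => g (Pi.single i 1)
  have hrepr (x : A) : x = ∑ i, T x i • a i := by
    have hx : g (T x) = x := LinearMap.congr_fun hg x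
    conv_lhs => rw [← hx, pi_eq_sum_univ' (T x), map_sum]
    simp only [map_smul, a]
  have hN0 : N 0 ≤ 0 := by simpa using hsmul 0 0
  refine .of_le_mul (C := ∑ i, N (a i)) (ENNReal.sum_ne_top.2 fun i _ => hN _) fun x _ => ?_
  calc N x ≤ ∑ i, N (T x i • a i) := by
        conv_lhs => rw [hrepr x]
        exact Finset.univ.le_sum_of_subadditive N hN0 hadd _
    _ ≤ ∑ i, N (a i) * ‖T x i‖ₑ :=
        Finset.sum_le_sum fun i _ => (hsmul _ _).trans_eq (mul_comm _ _)
    _ ≤ ∑ i, (∑ k, N (a k)) * ‖T x i‖ₑ := by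
        gcongr with i
        exact Finset.single_le_sum (f := fun k => N (a k)) (fun _ _ => zero_le) (Finset.mem_univ i)
    _ = _ := (Finset.mul_sum _ _ _).symm

section Spline

variable {Ω : Set (ℝ × ℝ)} {p : ℝ≥0∞} {γ : ℕ × ℕ} {P R : Finset (ℕ × ℕ)}

theorem HasWeakDeriv.sobNorm_shift_eq {u v : L1 Ω} (h : HasWeakDeriv Ω γ u v)
    (P : Finset (ℕ × ℕ)) (p : ℝ≥0∞) : sobNorm Ω (shift γ P) p u = sobNorm Ω P p v := by
  simp only [sobNorm, shift, Finset.sup_image, Function.comp_def,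
    Finset.sum_image (add_left_injective γ).injOn, h.derivNorm_add_eq]

theorem exists_hasWeakDeriv_of_zero_mem [Fact (1 ≤ p)] (hP0 : (0, 0) ∈ P) {v : L1 Ω}
    (hv : v ∈ sobolev Ω (shift γ P) p) : ∃ g, HasWeakDeriv Ω γ v g := by
  have h0 : ((0, 0) : ℕ × ℕ) + γ = γ := zero_add γ
  exact h0 ▸ exists_hasWeakDeriv_of_mem_sobolev hv hP0

variable [hp : Fact (1 ≤ p)] {S V : Submodule ℝ (L1 Ω)} {ι : Type*}

theorem dominatedOn_sobNorm_derivSpace [Fintype ι] (hS : S ≤ sobolev Ω (shift γ P) p)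
    (T : derivSpace γ S →ₗ[ℝ] (ι → ℝ)) (hT : Function.Injective T) :
    DominatedOn univ (fun w : derivSpace γ S => sobNorm Ω P p w) (fun w => ∑ i, ‖T w i‖ₑ) := by
  refine dominatedOn_sobNorm hp.out fun α hα => ?_
  refine dominatedOn_sum_enorm_of_injective T hT (fun v w => derivNorm_add_le hp.out _ _)
    (fun c w => derivNorm_smul_le c _) ?_
  rintro ⟨w, s, hs, hsw⟩
  rw [← hsw.derivNorm_add_eq]
  exact ((sobNorm_lt_top hp.out).1 (hS hs) _ (Finset.mem_image_of_mem _ hα)).ne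

theorem dominatedOn_sobNorm_of_functionals_eq [Finite ι] (hP0 : (0, 0) ∈ P) (hR0 : (0, 0) ∈ R)
    (hS : S ≤ sobolev Ω (shift γ P) p) (hRV : sobolev Ω R p ≤ V) (hSV : derivSpace γ S ≤ V)
    (F : ι → V →ₗ[ℝ] ℝ)
    (hFbounded : ∀ i, ∃ K : ℝ≥0, ∀ v : V,
      (v : L1 Ω) ∈ sobolev Ω R p → ‖F i v‖ₑ ≤ K * sobNorm Ω R p v)
    (hFnorming : ∀ s ∈ S, ∀ v : V, HasWeakDeriv Ω γ s v → (∀ i, F i v = 0) → v = 0) :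
    DominatedOn {x : L1 Ω × L1 Ω | x.1 ∈ sobolev Ω (shift γ R) p ∧ x.2 ∈ S ∧
        ∀ v w : V, HasWeakDeriv Ω γ x.2 v → HasWeakDeriv Ω γ x.1 w → ∀ i, F i v = F i w}
      (fun x => sobNorm Ω (shift γ P) p x.2) (fun x => sobNorm Ω (shift γ R) p x.1) := by
  cases nonempty_fintype ι
  set T : derivSpace γ S →ₗ[ℝ] (ι → ℝ) := LinearMap.pi fun i => F i ∘ₗ Submodule.inclusion hSV
  have hT : Function.Injective T := by
    rw [← LinearMap.ker_eq_bot, LinearMap.ker_eq_bot']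
    rintro ⟨w, s, hs, hsw⟩ h0
    have hw0 : w = 0 :=
      congr_arg Subtype.val (hFnorming s hs ⟨w, hSV ⟨s, hs, hsw⟩⟩ hsw (congr_fun h0))
    exact Subtype.ext hw0
  obtain ⟨C, hC⟩ := dominatedOn_sobNorm_derivSpace hS T hT
  choose K hK using hFbounded
  refine ⟨C * ∑ i, K i, ?_⟩
  rintro ⟨u, s⟩ ⟨hu, hs, hF⟩
  obtain ⟨w, hw⟩ := exists_hasWeakDeriv_of_zero_mem hR0 hu
  obtain ⟨v, hv⟩ := exists_hasWeakDeriv_of_zero_mem hP0 (hS hs)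
  have hvS : v ∈ derivSpace γ S := ⟨s, hs, hv⟩
  have hwR : w ∈ sobolev Ω R p := (hw.sobNorm_shift_eq R p).symm.trans_lt hu
  simp only [hw.sobNorm_shift_eq, hv.sobNorm_shift_eq]
  calc sobNorm Ω P p v ≤ C * ∑ i, ‖F i ⟨v, hSV hvS⟩‖ₑ := hC ⟨v, hvS⟩ (mem_univ _)
    _ = C * ∑ i, ‖F i ⟨w, hRV hwR⟩‖ₑ := by simp only [hF ⟨v, hSV hvS⟩ ⟨w, hRV hwR⟩ hv hw]
    _ ≤ C * ∑ i, K i * sobNorm Ω R p w := by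
        gcongr with i
        exact hK i ⟨w, hRV hwR⟩ hwR
    _ = _ := by
        rw [← Finset.sum_mul, ← ENNReal.ofNNReal_finsetSum, ← mul_assoc, ENNReal.coe_mul]

end Spline

/-! ### The interpolation error -/

section Interpolation

variable (M : MacroElement) (μ : ℕ) {p : ℝ≥0∞} [hp : Fact (1 ≤ p)] {γ : ℕ × ℕ}
  {P Q : Finset (ℕ × ℕ)}

theorem MacroElement.dominatedOn_sobNorm_sub_meanPolynomial :
    DominatedOn {w : M.CSpace μ × M.CSpace μ |
        M.toL1 μ w.1 ∈ sobolev M.Ω (shift γ (hull Q)) p ∧ M.IsMeanPolynomial Q γ w.1 w.2}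
      (fun w => sobNorm M.Ω (shift γ (hull Q)) p (M.toL1 μ (w.1 - w.2)))
      (fun w => sobSemi M.Ω (shift γ Q) p (M.toL1 μ w.1)) :=
  dominatedOn_sobNorm hp.out <| Finset.forall_mem_image.2 fun _ hβ =>
    (M.dominatedOn_derivNorm_sub_meanPolynomial μ hp.out hβ).comp (φ := id) fun _ hw =>
      ⟨fun _ hα => exists_hasWeakDeriv_of_mem_sobolev hw.1 hα, hw.2⟩

variable {M μ}

theorem MacroElement.IsMeanPolynomial.sub_mem_sobolev {u q : M.CSpace μ}
    (hq : M.IsMeanPolynomial Q γ u q) (hu : M.toL1 μ u ∈ sobolev M.Ω (shift γ (hull Q)) p) :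
    M.toL1 μ (u - q) ∈ sobolev M.Ω (shift γ (hull Q)) p := by
  obtain ⟨C, hC⟩ := M.dominatedOn_sobNorm_sub_meanPolynomial μ (p := p) (γ := γ) (Q := Q)
  refine (hC (u, q) ⟨hu, hq⟩).trans_lt (ENNReal.mul_lt_top ENNReal.coe_lt_top ?_)
  exact (sobSemi_shift γ Q p _).trans_lt <| (sobNorm_lt_top hp.out).2 fun β hβ =>
    (sobNorm_lt_top hp.out).1 hu β (Finset.image_subset_image Finset.sdiff_subset hβ)

theorem dominatedOn_sobNorm_sub_interpolant {S : Submodule ℝ (L1 M.Ω)} (I : M.CSpace μ →ₗ[ℝ] S)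
    (hPQ : P ⊆ hull Q)
    (hI : DominatedOn {w : M.CSpace μ | M.toL1 μ w ∈ sobolev M.Ω (shift γ (hull Q)) p}
      (fun w => sobNorm M.Ω (shift γ P) p (I w))
      (fun w => sobNorm M.Ω (shift γ (hull Q)) p (M.toL1 μ w))) :
    DominatedOn {w : M.CSpace μ × M.CSpace μ |
        M.toL1 μ w.1 ∈ sobolev M.Ω (shift γ (hull Q)) p ∧ M.IsMeanPolynomial Q γ w.1 w.2}
      (fun w => sobNorm M.Ω (shift γ P) p (M.toL1 μ w.1 - I w.1))
      (fun w => sobSemi M.Ω (shift γ Q) p (M.toL1 μ w.1) +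
        sobNorm M.Ω (shift γ P) p (M.toL1 μ w.2 - I w.2)) := by
  have hsemi := (M.dominatedOn_sobNorm_sub_meanPolynomial μ (p := p) (γ := γ) (Q := Q)).trans
    (.of_le fun w _ => le_add_of_nonneg_right
      (zero_le (a := sobNorm M.Ω (shift γ P) p (M.toL1 μ w.2 - I w.2))))
  have hinterp := (hI.comp (φ := fun w : M.CSpace μ × M.CSpace μ => w.1 - w.2)
    fun w hw => hw.2.sub_mem_sobolev hw.1).trans hsemi
  refine dominatedOn_sobNorm hp.out fun α hα => .trans (.of_le fun w _ => ?_)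
    (.add (.add hsemi hinterp) (.of_le fun w _ => le_add_self))
  have hα' : α ∈ shift γ (hull Q) := Finset.image_subset_image hPQ hα
  have hsplit : M.toL1 μ w.1 - (I w.1 : L1 M.Ω) =
      (M.toL1 μ (w.1 - w.2) - I (w.1 - w.2)) + (M.toL1 μ w.2 - I w.2) := by
    rw [map_sub, map_sub, Submodule.coe_sub]
    abel
  rw [hsplit]
  refine (derivNorm_add_le hp.out _ _).trans (add_le_add ?_ (derivNorm_le_sobNorm hp.out hα _))
  exact (derivNorm_sub_le hp.out _ _).trans
    (add_le_add (derivNorm_le_sobNorm hp.out hα' _) (derivNorm_le_sobNorm hp.out hα _))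

end Interpolation

theorem lemma3_general (M : MacroElement) (p : ℝ≥0∞) [Fact (1 ≤ p)] (γ : ℕ × ℕ)
    (P Q : Finset (ℕ × ℕ)) (hP0 : (0, 0) ∈ P) (hPQ : P ⊆ hull Q)
    (S : Submodule ℝ (L1 M.Ω)) (hS : S ≤ sobolev M.Ω (shift γ P) p)
    (μ : ℕ) (I : M.CSpace μ →ₗ[ℝ] S) {ι : Type*} [Finite ι]
    (F : ι → (sobolev M.Ω (hull Q) p ⊔ derivSpace γ S : Submodule ℝ (L1 M.Ω)) →ₗ[ℝ] ℝ)
    (hFbounded : ∀ i, ∃ K : ℝ≥0,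
      ∀ v : (sobolev M.Ω (hull Q) p ⊔ derivSpace γ S : Submodule ℝ (L1 M.Ω)),
        (v : L1 M.Ω) ∈ sobolev M.Ω (hull Q) p → ‖F i v‖ₑ ≤ K * sobNorm M.Ω (hull Q) p v)
    (hFpreserved : ∀ u : M.CSpace μ, M.toL1 μ u ∈ sobolev M.Ω (shift γ (hull Q)) p →
      ∀ v w : (sobolev M.Ω (hull Q) p ⊔ derivSpace γ S : Submodule ℝ (L1 M.Ω)),
        HasWeakDeriv M.Ω γ (I u) v → HasWeakDeriv M.Ω γ (M.toL1 μ u) w →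
          ∀ i, F i v = F i w)
    (hFnorming : ∀ s ∈ S,
      ∀ v : (sobolev M.Ω (hull Q) p ⊔ derivSpace γ S : Submodule ℝ (L1 M.Ω)),
        HasWeakDeriv M.Ω γ s v → (∀ i, F i v = 0) → v = 0) :
    (∀ u : M.CSpace μ, M.toL1 μ u ∈ sobolev M.Ω (shift γ (hull Q)) p →
      ∃! q : M.CSpace μ, M.IsMeanPolynomial Q γ u q) ∧
    ∃ C : ℝ≥0, ∀ u : M.CSpace μ, M.toL1 μ u ∈ sobolev M.Ω (shift γ (hull Q)) p →
      ∀ q : M.CSpace μ, M.IsMeanPolynomial Q γ u q →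
        sobNorm M.Ω (shift γ P) p (M.toL1 μ u - I u) ≤
          C * (sobSemi M.Ω (shift γ Q) p (M.toL1 μ u) +
            sobNorm M.Ω (shift γ P) p (M.toL1 μ q - I q)) := by
  refine ⟨fun u hu => M.existsUnique_isMeanPolynomial μ fun α hα =>
    exists_hasWeakDeriv_of_mem_sobolev hu (subset_hull Q hα), ?_⟩
  have hI : DominatedOn {w : M.CSpace μ | M.toL1 μ w ∈ sobolev M.Ω (shift γ (hull Q)) p}
      (fun w => sobNorm M.Ω (shift γ P) p (I w))
      (fun w => sobNorm M.Ω (shift γ (hull Q)) p (M.toL1 μ w)) :=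
    (dominatedOn_sobNorm_of_functionals_eq hP0 (hPQ hP0) hS le_sup_left le_sup_right F hFbounded
      hFnorming).comp (φ := fun w => (M.toL1 μ w, (I w : L1 M.Ω))) fun w hw =>
        And.intro hw ⟨(I w).2, hFpreserved w hw⟩
  obtain ⟨C, hC⟩ := dominatedOn_sobNorm_sub_interpolant I hPQ hI
  exact ⟨C, fun u hu q hq => hC (u, q) ⟨hu, hq⟩⟩

theorem lemma3 (M : MacroElement) (p : ℝ≥0∞) [Fact (1 ≤ p)] (γ : ℕ × ℕ)
    (P Q : Finset (ℕ × ℕ)) (hP0 : (0, 0) ∈ P) (hQ0 : (0, 0) ∈ Q) (hPQ : P ⊆ hull Q)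
    -- the spline space
    (S : Submodule ℝ (L1 M.Ω)) (hSpoly : M.IsPiecewisePolynomial S)
    (hS : S ≤ sobolev M.Ω (shift γ P) p)
    -- the interpolation operator
    (μ : ℕ) (I : M.CSpace μ →ₗ[ℝ] S)
    -- the associated functionals
    (j : ℕ) (hj : j = Module.finrank ℝ (derivSpace γ S))
    (F : Fin j → (sobolev M.Ω (hull Q) p ⊔ derivSpace γ S : Submodule ℝ (L1 M.Ω)) →ₗ[ℝ] ℝ)
    (hFbounded : ∀ i, ∃ K : ℝ≥0,
      ∀ v : (sobolev M.Ω (hull Q) p ⊔ derivSpace γ S : Submodule ℝ (L1 M.Ω)),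
        (v : L1 M.Ω) ∈ sobolev M.Ω (hull Q) p → ‖F i v‖ₑ ≤ K * sobNorm M.Ω (hull Q) p v)
    (hFpreserved : ∀ u : M.CSpace μ, M.toL1 μ u ∈ sobolev M.Ω (shift γ (hull Q)) p →
      ∀ v w : (sobolev M.Ω (hull Q) p ⊔ derivSpace γ S : Submodule ℝ (L1 M.Ω)),
        HasWeakDeriv M.Ω γ (I u) v → HasWeakDeriv M.Ω γ (M.toL1 μ u) w →
          ∀ i, F i v = F i w)
    (hFnorming : ∀ s ∈ S,
      ∀ v : (sobolev M.Ω (hull Q) p ⊔ derivSpace γ S : Submodule ℝ (L1 M.Ω)),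
        HasWeakDeriv M.Ω γ s v → (∀ i, F i v = 0) → v = 0) :
    (∀ u : M.CSpace μ, M.toL1 μ u ∈ sobolev M.Ω (shift γ (hull Q)) p →
      ∃! q : M.CSpace μ, M.IsMeanPolynomial Q γ u q) ∧
    ∃ C : ℝ≥0, ∀ u : M.CSpace μ, M.toL1 μ u ∈ sobolev M.Ω (shift γ (hull Q)) p →
      ∀ q : M.CSpace μ, M.IsMeanPolynomial Q γ u q →
        sobNorm M.Ω (shift γ P) p (M.toL1 μ u - I u) ≤
          C * (sobSemi M.Ω (shift γ Q) p (M.toL1 μ u) +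
            sobNorm M.Ω (shift γ P) p (M.toL1 μ q - I q)) :=
  lemma3_general M p γ P Q hP0 hPQ S hS μ I F hFbounded hFpreserved hFnorming
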